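/- Let $\phi=(1+\sqrt5)/2$. For $0<q<1$ let $R(q)$ be the Rogers–Ramanujan continued fraction $$R(q)=\cfrac{q^{1/5}}{1+\cfrac{q}{1+\cfrac{q^2}{1+\cfrac{q^3}{1+\cdots}}}},$$ that is, the limit of its convergents. Roots of positive reals are the positive ones, and $R^5(q)=(R(q))^5$. The continued fraction converges for every $0<q<1$, and the following hold. **Reciprocity.** If $\alpha,\beta>0$ and $\alpha\beta=\pi^2$, then $$R(e^{-2\alpha})=\left(\frac{\phi+\frac1\phi}{\phi+R(e^{-2\beta})}-1\right)\phi=\frac{1-\phi R(e^{-2\beta})}{\phi+R(e^{-2\beta})}.$$ If $\alpha,\beta>0$ and $\alpha\beta=\pi^2/5$, then $$R^5(e^{-2\alpha})=\left(\frac{\phi^5+\frac1{\phi^5}}{\phi^5+R^5(e^{-2\beta})}-1\right)\phi^5=\frac{1-\phi^5R^5(e^{-2\beta})}{\phi^5+R^5(e^{-2\beta})}.$$ In particular, for every integer $n\ge0$, $$R\left(e^{-2\pi(\sqrt5)^n}\right)=\frac{1-\phi R\left(e^{-2\pi/(\sqrt5)^n}\right)}{\phi+R\left(e^{-2\pi/(\sqrt5)^n}\right)},\qquad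 R^5\left(e^{-2\pi/(\sqrt5)^{n+2}}\right)=\frac{1-\phi^5R^5\left(e^{-2\pi(\sqrt5)^n}\right)}{\phi^5+R^5\left(e^{-2\pi(\sqrt5)^n}\right)}.$$ **(1)** Put $x=\sqrt{\phi^2+1}-\phi$. Then $$R(e^{-2\pi})=x,\qquad R^5(e^{-2\pi/5})=\frac{1-\phi^5x^5}{\phi^5+x^5},\qquad R(e^{-10\pi})=\frac{\sqrt[5]{\phi^5+x^5}-\phi\sqrt[5]{1-\phi^5x^5}}{\phi\sqrt[5]{\phi^5+x^5}+\sqrt[5]{1-\phi^5x^5}}.$$ **(2)** Put $z=\sqrt[5]{\sqrt{\phi^{10}+1}-\phi^5}$, $N=(\phi+z)^5-\phi^5(1-\phi z)^5$ and $M=\phi^5(\phi+z)^5+(1-\phi z)^5$. Then $$R^5(e^{-2\pi/\sqrt5})=\sqrt{\phi^{10}+1}-\phi^5,\qquad R(e^{-2\pi\sqrt5})=\frac{1-\phi z}{\phi+z},$$ $$\cfrac{1}{1+\cfrac{e^{-2\pi\sqrt5}}{1+\cfrac{e^{-4\pi\sqrt5}}{1+\cdots}}}=\left[\frac{\sqrt5}{1+\sqrt[5]{5^{3/4}\left(\frac{\sqrt5-1}{2}\right)^{5/2}-1}}-\frac{\sqrt5+1}{2}\right]e^{2\pi/\sqrt5},$$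 $$R^5\left(e^{-2\pi/(5\sqrt5)}\right)=\frac NM,\qquad R(e^{-10\sqrt5\,\pi})=\frac{\sqrt[5]{M}-\phi\sqrt[5]{N}}{\phi\sqrt[5]{M}+\sqrt[5]{N}}.$$ **(3)** Put $P=\phi+\frac1\phi-\phi\sqrt\phi$, $Q=\sqrt\phi-\frac1\phi\sqrt{\phi+\frac1\phi}$, $S=\phi+\frac1\phi-\sqrt{\phi+\frac1\phi}$ and $T=Q-\phi P$. Then $$R(e^{-\pi})=\frac{-\sqrt{\sqrt5}\,(\sqrt5+5)+\sqrt{2\sqrt5+5}+\sqrt{5(2\sqrt5+5)}}{2\left(\sqrt5-\sqrt{2\sqrt5+5}\right)}=\frac PQ,\qquad R(e^{-4\pi})=\frac TS,$$ $$R^5(e^{-4\pi/5})=\frac{Q^5-\phi^5P^5}{\phi^5Q^5+P^5},\qquad R^5(e^{-\pi/5})=\frac{S^5-\phi^5T^5}{\phi^5S^5+T^5}.$$ -/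

import Mathlib

open Real Filter Topology
open scoped goldenRatio

noncomputable section

/-- The infinite continued fraction
`a / (1 + q / (1 + q ^ 2 / (1 + q ^ 3 / (1 + ⋯))))`:
integer part `0`, all partial denominators `1`, first partial numerator `a`, and the partial
numerator with index `n ≥ 1` equal to `q ^ n`. -/
def rrContFract (a q : ℝ) : GenContFract ℝ where
  h := 0
  s := Stream'.Seq.ofStream fun n : ℕ => ⟨if n = 0 then a else q ^ n, 1⟩

/-- The Rogers-Ramanujan continued fraction
`R(q) = q ^ (1/5) / (1 + q / (1 + q ^ 2 / (1 + q ^ 3 / (1 + ⋯))))` for `0 < q < 1`,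
that is, the limit of the convergents (with the positive fifth root of `q`). -/
def rrR (q : ℝ) : ℝ :=
  limUnder atTop (rrContFract (q ^ (1 / 5 : ℝ)) q).convs

end

/-! Let N and D be the theta series `rrNum` and `rrDen`. Rogers' two auxiliary series satisfy
functional equations which, after normalization, give a positive solution, with positive limit, of
the recurrence adjoint to that of the convergents. Hence the fraction converges and R(q) = q^(1/5)
N(q) / D(q).

First reciprocity: Poisson summation (`thetaSeries_poisson`) sends N and D at e^(-2α) to theta
series of nome p = e^(-2β/5) whose argument is a fifth root of -1. Their dissection modulo 5
(`thetaSeries_dissection`) expresses them through N(p^5) and D(p^5), with coefficients built from z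
+ 1/z = φ. The quotient is the stated Möbius map of R(e^(-2β)).

Second reciprocity: N(x)D(x) is a quadratic form in N(x^5), D(x^5), which factors over ℚ(φ).
Multiplying over the fifth roots of unity gives 1/R^5 - 11 - R^5 = η(τ)^6 / η(5τ)^6
(`icosahedral_form_eq`, `rrR_pow_five_eta`). Inversion of η makes the product of this quantity at α
and β equal to 125. The resulting polynomial relation splits into two Möbius relations, and 0 < R <
1 excludes one.

Values: the points α = π and α = π/√5 are self-dual, so R or R^5 there is the positive fixed point
of an involution. The modular equation of degree two carries e^(-2π) to e^(-4π), whose value is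
singled out among the roots of a cubic by numerical bounds. Reciprocity yields the rest. -/

/-! ### Two-sided theta series. -/

/-- The exponent `n (n - 1) / 2`. -/
def binomTwo (n : ℤ) : ℤ := n * (n - 1) / 2

theorem two_mul_binomTwo (n : ℤ) : 2 * binomTwo n = n * (n - 1) :=
  Int.mul_ediv_cancel' (even_iff_two_dvd.mp (Int.even_mul_pred_self n))

/-- The general term of the theta series. -/
noncomputable def thetaTerm (z p : ℂ) (n : ℤ) : ℂ := z ^ n * p ^ binomTwo n

/-- The two-sided theta series `∑ z ^ n * p ^ (n (n - 1) / 2)`. -/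
noncomputable def thetaSeries (z p : ℂ) : ℂ := ∑' n : ℤ, thetaTerm z p n

theorem thetaTerm_succ {z p : ℂ} (hz : z ≠ 0) (hp : p ≠ 0) (n : ℤ) :
    thetaTerm z p (n + 1) = thetaTerm z p n * (z * p ^ n) := by
  have h : binomTwo (n + 1) = binomTwo n + n := by
    linarith [two_mul_binomTwo n, two_mul_binomTwo (n + 1)]
  rw [thetaTerm, thetaTerm, h, zpow_add₀ hz, zpow_add₀ hp]
  simp only [zpow_one]
  ring

theorem thetaTerm_ne_zero {z p : ℂ} (hz : z ≠ 0) (hp : p ≠ 0) (n : ℤ) : thetaTerm z p n ≠ 0 :=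
  mul_ne_zero (zpow_ne_zero _ hz) (zpow_ne_zero _ hp)

theorem thetaTerm_neg {z p : ℂ} (hp : p ≠ 0) (n : ℤ) :
    thetaTerm z p (-n) = thetaTerm (p / z) p n := by
  have h : binomTwo (-n) = n + binomTwo n := by
    linarith [two_mul_binomTwo n, two_mul_binomTwo (-n)]
  rw [thetaTerm, thetaTerm, h, zpow_add₀ hp, div_zpow, zpow_neg]
  ring

theorem summable_thetaTerm_nat {z p : ℂ} (hz : z ≠ 0) (hp : p ≠ 0) (hp1 : ‖p‖ < 1) :
    Summable fun n : ℕ => ‖thetaTerm z p n‖ := by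
  refine summable_of_ratio_test_tendsto_lt_one (l := 0) one_pos
    (Eventually.of_forall fun n => norm_ne_zero_iff.mpr (thetaTerm_ne_zero hz hp n)) ?_
  have h : ∀ n : ℕ, ‖‖thetaTerm z p ((n + 1 : ℕ) : ℤ)‖‖ / ‖‖thetaTerm z p n‖‖
      = ‖z‖ * ‖p‖ ^ n := by
    intro n
    rw [Nat.cast_succ, thetaTerm_succ hz hp]
    simp only [norm_norm, norm_mul, zpow_natCast, norm_pow]
    rw [mul_div_cancel_left₀ _ (norm_ne_zero_iff.mpr (thetaTerm_ne_zero hz hp n))]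
  simp only [h]
  simpa using (tendsto_pow_atTop_nhds_zero_of_lt_one (norm_nonneg p) hp1).const_mul ‖z‖

theorem summable_norm_thetaTerm {z p : ℂ} (hz : z ≠ 0) (hp : p ≠ 0) (hp1 : ‖p‖ < 1) :
    Summable fun n : ℤ => ‖thetaTerm z p n‖ := by
  refine Summable.of_nat_of_neg (summable_thetaTerm_nat hz hp hp1) ?_
  simpa only [thetaTerm_neg hp] using summable_thetaTerm_nat (div_ne_zero hp hz) hp hp1

theorem summable_thetaTerm {z p : ℂ} (hz : z ≠ 0) (hp : p ≠ 0) (hp1 : ‖p‖ < 1) :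
    Summable fun n : ℤ => thetaTerm z p n :=
  (summable_norm_thetaTerm hz hp hp1).of_norm

theorem thetaSeries_div {z p : ℂ} (hp : p ≠ 0) :
    thetaSeries (p / z) p = thetaSeries z p := by
  rw [thetaSeries, thetaSeries, ← (Equiv.neg ℤ).tsum_eq (thetaTerm z p)]
  exact tsum_congr fun n => (thetaTerm_neg hp n).symm

/-! ### Euler products and the Jacobi triple product. -/

/-- The finite product `(1 - p) (1 - p ^ 2) ⋯ (1 - p ^ n)`. -/
noncomputable def eulerPartial (p : ℂ) (n : ℕ) : ℂ := ∏ i ∈ Finset.range n, (1 - p ^ (i + 1))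

/-- The infinite product `(1 - p) (1 - p ^ 2) (1 - p ^ 3) ⋯`. -/
noncomputable def eulerProd (p : ℂ) : ℂ := ∏' i : ℕ, (1 - p ^ (i + 1))

theorem one_sub_pow_ne_zero {p : ℂ} (hp1 : ‖p‖ < 1) (n : ℕ) : 1 - p ^ (n + 1) ≠ 0 := by
  intro h
  have h1 : ‖p ^ (n + 1)‖ < 1 := by
    rw [norm_pow]; exact pow_lt_one₀ (norm_nonneg _) hp1 n.succ_ne_zero
  rw [← sub_eq_zero.mp h] at h1
  simp at h1

theorem eulerProd_ne_zero {p : ℂ} (hp1 : ‖p‖ < 1) : eulerProd p ≠ 0 := by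
  have := tprod_one_add_ne_zero_of_summable (f := fun n : ℕ => -p ^ (n + 1))
    (fun i => by simpa [← sub_eq_add_neg] using one_sub_pow_ne_zero hp1 i) (by
      simpa using (summable_nat_add_iff 1).mpr
        (summable_geometric_of_lt_one (norm_nonneg _) hp1))
  simpa [eulerProd, sub_eq_add_neg] using this

theorem tendsto_eulerPartial {p : ℂ} (hp1 : ‖p‖ < 1) :
    Tendsto (eulerPartial p) atTop (𝓝 (eulerProd p)) :=
  (ModularForm.multipliable_one_sub_pow hp1).tendsto_prod_tprod_nat

/-- The reciprocal of `eulerPartial`, extended by `0` to negative indices. -/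
noncomputable def eulerPartialInv (p : ℂ) (n : ℤ) : ℂ := if n < 0 then 0 else (eulerPartial p n.toNat)⁻¹

/-- The extension by zero is compatible with the recursion because the factor 1 - p^n vanishes at n
= 0; no boundary cases then arise in the finite triple product. -/
theorem eulerPartialInv_sub_one {p : ℂ} (hp1 : ‖p‖ < 1) (n : ℤ) :
    eulerPartialInv p (n - 1) = (1 - p ^ n) * eulerPartialInv p n := by
  rcases lt_trichotomy n 0 with h | rfl | h
  · simp [eulerPartialInv, h, show n < 1 by omega]
  · simp [eulerPartialInv]
  · obtain ⟨m, rfl⟩ : ∃ m : ℕ, n = (m : ℤ) + 1 := ⟨(n - 1).toNat, by omega⟩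
    have h1 : ¬ ((m : ℤ) + 1 < 0) := by omega
    have h2 : ((m : ℤ) + 1).toNat = m + 1 := by omega
    simp only [eulerPartialInv, add_sub_cancel_right, h1, h2, Int.toNat_natCast, if_false,
      eulerPartial, Finset.prod_range_succ]
    have := one_sub_pow_ne_zero hp1 m
    have h3 : p ^ ((m : ℤ) + 1) = p ^ (m + 1) := by exact_mod_cast zpow_natCast p (m + 1)
    rw [h3, mul_inv, if_neg (by omega)]
    field_simp

theorem exists_norm_eulerPartialInv_le {p : ℂ} (hp1 : ‖p‖ < 1) :
    ∃ C, 0 ≤ C ∧ ∀ n, ‖eulerPartialInv p n‖ ≤ C := by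
  have h := (tendsto_eulerPartial hp1).inv₀ (eulerProd_ne_zero hp1)
  obtain ⟨C, hC⟩ := h.norm.bddAbove_range
  have hC' : ∀ n, ‖(eulerPartial p n)⁻¹‖ ≤ C := fun n => hC ⟨n, rfl⟩
  refine ⟨C, (norm_nonneg _).trans (hC' 0), fun n => ?_⟩
  rw [eulerPartialInv]
  split_ifs
  · simpa using (norm_nonneg _).trans (hC' 0)
  · exact hC' _

theorem tendsto_eulerPartialInv {p : ℂ} (hp1 : ‖p‖ < 1) {u : ℕ → ℤ} (hu : Tendsto u atTop atTop) :
    Tendsto (fun n => eulerPartialInv p (u n)) atTop (𝓝 (eulerProd p)⁻¹) := by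
  have h0 : Tendsto Int.toNat atTop atTop :=
    tendsto_atTop.mpr fun n => (eventually_ge_atTop (n : ℤ)).mono fun m hm => by omega
  have h := ((tendsto_eulerPartial hp1).inv₀ (eulerProd_ne_zero hp1)).comp
    (h0.comp hu)
  refine h.congr' ?_
  filter_upwards [hu.eventually_ge_atTop 0] with n hn
  simp [eulerPartialInv, not_lt.mpr hn]

/-- A finite form of the Jacobi triple product identity. -/
theorem hasSum_finite_triple_product {z p : ℂ} (hz : z ≠ 0) (hp : p ≠ 0) (hp1 : ‖p‖ < 1) (N : ℕ) :
    HasSum (fun k : ℤ => thetaTerm z p k *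
        (eulerPartial p (2 * N) * eulerPartialInv p (N + k) * eulerPartialInv p (N - k)))
      (∏ i ∈ Finset.range N, ((1 + z * p ^ i) * (1 + p ^ (i + 1) / z))) := by
  induction N with
  | zero =>
    convert hasSum_single (0 : ℤ) ?_ using 1
    · simp [thetaTerm, binomTwo, eulerPartial, eulerPartialInv]
    · intro k hk
      rcases lt_or_gt_of_ne hk with h | h <;> simp [eulerPartialInv, h]
  | succ N ih =>
    rw [Finset.prod_range_succ]
    -- The coefficients are Gaussian binomials [2N, N + k]. The new factor has four monomials, two
    -- of which shift the index k by one; comparing coefficients amounts to the q-Pascal rule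
    -- applied twice.
    have h1 := ih.mul_right (1 + p ^ (2 * N + 1))
    have h2 := ((Equiv.subRight (1 : ℤ)).hasSum_iff.mpr ih).mul_right (z * p ^ N)
    have h3 := ((Equiv.addRight (1 : ℤ)).hasSum_iff.mpr ih).mul_right (p ^ (N + 1) / z)
    have h := (h1.add h2).add h3
    rw [← mul_add, ← mul_add] at h
    have hfac : (1 + z * p ^ N) * (1 + p ^ (N + 1) / z) =
        1 + p ^ (2 * N + 1) + z * p ^ N + p ^ (N + 1) / z := by
      field_simp
      ring
    rw [hfac]
    refine (congrArg (HasSum · _) (funext fun k => ?_)).mpr h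
    simp only [Function.comp_apply, Equiv.subRight_apply, Equiv.coe_addRight, Nat.cast_succ]
    have e1 := eulerPartialInv_sub_one hp1 ((N : ℤ) + 1 + k)
    have e2 := eulerPartialInv_sub_one hp1 ((N : ℤ) + 1 - k)
    have e3 := eulerPartialInv_sub_one hp1 ((N : ℤ) + k)
    have e4 := eulerPartialInv_sub_one hp1 ((N : ℤ) - k)
    rw [show (N : ℤ) + 1 + k - 1 = N + k by ring] at e1
    rw [show (N : ℤ) + 1 - k - 1 = N - k by ring] at e2
    have t1 := thetaTerm_succ hz hp (k - 1)
    rw [sub_add_cancel] at t1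
    have t2 := thetaTerm_succ hz hp k
    rw [show (N : ℤ) + (k - 1) = N + k - 1 by ring, show (N : ℤ) - (k - 1) = N + 1 - k by ring,
      show (N : ℤ) + (k + 1) = N + 1 + k by ring, show (N : ℤ) - (k + 1) = N - k - 1 by ring,
      e3, e4, e1, e2, t2]
    have hm : thetaTerm z p (k - 1) = thetaTerm z p k / (z * p ^ (k - 1)) := by
      rw [t1, mul_div_cancel_right₀ _ (mul_ne_zero hz (zpow_ne_zero _ hp))]
    rw [hm, show 2 * (N + 1) = 2 * N + 1 + 1 by ring]
    simp only [eulerPartial, Finset.prod_range_succ]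
    simp only [zpow_add₀ hp, zpow_sub₀ hp, zpow_natCast, zpow_one]
    have hx : p ^ k ≠ 0 := zpow_ne_zero _ hp
    generalize p ^ k = x at *
    field_simp
    ring

/-- The Jacobi triple product identity, as a limit of finite products. -/
theorem tendsto_triple_product {z p : ℂ} (hz : z ≠ 0) (hp : p ≠ 0) (hp1 : ‖p‖ < 1) :
    Tendsto (fun N : ℕ => eulerPartial p N *
        ∏ i ∈ Finset.range N, ((1 + z * p ^ i) * (1 + p ^ (i + 1) / z)))
      atTop (𝓝 (thetaSeries z p)) := by
  obtain ⟨C, hC0, hC⟩ := exists_norm_eulerPartialInv_le hp1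
  obtain ⟨D, hD⟩ := (tendsto_eulerPartial hp1).norm.bddAbove_range
  have hD' : ∀ n, ‖eulerPartial p n‖ ≤ D := fun n => hD ⟨n, rfl⟩
  have hD0 : 0 ≤ D := (norm_nonneg _).trans (hD' 0)
  -- Each Gaussian binomial tends to 1 / `eulerProd p` and is bounded by D * C * C uniformly in N
  -- and k, so the limit passes under the sum.
  have key : Tendsto (fun N : ℕ => ∑' k : ℤ, thetaTerm z p k *
        (eulerPartial p (2 * N) * eulerPartialInv p (N + k) * eulerPartialInv p (N - k)))
      atTop (𝓝 (∑' k : ℤ, thetaTerm z p k *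
        (eulerProd p * (eulerProd p)⁻¹ * (eulerProd p)⁻¹))) := by
    refine tendsto_tsum_of_dominated_convergence
      ((summable_norm_thetaTerm hz hp hp1).mul_right (D * C * C)) (fun k => ?_)
      (Eventually.of_forall fun N k => ?_)
    · refine Tendsto.const_mul _ (((Tendsto.comp (tendsto_eulerPartial hp1) ?_).mul
        (tendsto_eulerPartialInv hp1 ?_)).mul (tendsto_eulerPartialInv hp1 ?_))
      · exact tendsto_id.const_mul_atTop' (by norm_num)
      · exact tendsto_atTop_add_const_right _ _ tendsto_natCast_atTop_atTop
      · simpa [sub_eq_add_neg] using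
          tendsto_atTop_add_const_right _ (-k) (tendsto_natCast_atTop_atTop (R := ℤ))
    · rw [norm_mul, norm_mul, norm_mul]
      gcongr
      exacts [hD' _, hC _, hC _]
  have hE := eulerProd_ne_zero hp1
  simp only [(hasSum_finite_triple_product hz hp hp1 _).tsum_eq, mul_inv_cancel₀ hE, one_mul] at key
  have := (tendsto_eulerPartial hp1).mul key
  rwa [tsum_mul_right, mul_comm _ (eulerProd p)⁻¹, ← mul_assoc, mul_inv_cancel₀ hE, one_mul] at this

/-! ### Products of two theta series. -/

/-- Pairs with m ≡ n modulo 2 form a lattice of index two, whose other coset is the shift by (1, 0).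
The substitution turns m² + n² into 2(i² + j²) up to linear terms, so exponents decouple. -/
theorem bijective_parity_split :
    Function.Bijective fun t : Fin 2 × ℤ × ℤ => (t.2.1 + t.2.2 + (t.1 : ℕ), t.2.1 - t.2.2) := by
  constructor
  · rintro ⟨c, i, j⟩ ⟨c', i', j'⟩ h
    simp only [Prod.mk.injEq] at h
    have hc := c.isLt
    have hc' := c'.isLt
    simp only [Prod.mk.injEq, Fin.ext_iff]
    omega
  · rintro ⟨m, n⟩
    refine ⟨(⟨((m - n) % 2).toNat, by omega⟩, n + (m - n) / 2, (m - n) / 2), ?_⟩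
    simp only [Prod.mk.injEq]
    omega

/-- The product of two theta series with the same nome, split by parity. -/
theorem thetaSeries_mul_thetaSeries {x y p : ℂ} (hx : x ≠ 0) (hy : y ≠ 0) (hp : p ≠ 0)
    (hp1 : ‖p‖ < 1) :
    thetaSeries x p * thetaSeries y p =
      thetaSeries (x * y) (p ^ 2) * thetaSeries (x * p / y) (p ^ 2) +
      x * (thetaSeries (x * y * p) (p ^ 2) * thetaSeries (x * p ^ 2 / y) (p ^ 2)) := by
  have hp2 : p ^ 2 ≠ 0 := pow_ne_zero 2 hp
  have hp21 : ‖p ^ 2‖ < 1 := by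
    rw [norm_pow]; exact pow_lt_one₀ (norm_nonneg _) hp1 two_ne_zero
  have hs : ∀ {z : ℂ}, z ≠ 0 → Summable fun n : ℤ => ‖thetaTerm z (p ^ 2) n‖ :=
    fun hz => summable_norm_thetaTerm hz hp2 hp21
  have h1 := summable_norm_thetaTerm hx hp hp1
  have h2 := summable_norm_thetaTerm hy hp hp1
  have hsum := summable_mul_of_summable_norm h1 h2
  have hxy := mul_ne_zero hx hy
  simp only [thetaSeries]
  rw [tsum_mul_tsum_of_summable_norm h1 h2,
    tsum_mul_tsum_of_summable_norm (hs hxy) (hs (div_ne_zero (mul_ne_zero hx hp) hy)),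
    tsum_mul_tsum_of_summable_norm (hs (mul_ne_zero hxy hp)) (hs (div_ne_zero (mul_ne_zero hx hp2) hy)),
    ← (Equiv.ofBijective _ bijective_parity_split).tsum_eq, Summable.tsum_prod, tsum_fintype,
    Fin.sum_univ_two, ← tsum_mul_left]
  · congr 1
    · refine tsum_congr fun t => ?_
      obtain ⟨i, j⟩ := t
      have e1 := two_mul_binomTwo (i + j)
      have e2 := two_mul_binomTwo (i - j)
      have e3 := two_mul_binomTwo i
      have e4 := two_mul_binomTwo j
      have he : binomTwo (i + j) + binomTwo (i - j) = 2 * binomTwo i + j + 2 * binomTwo j := by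
        linarith
      simp only [Equiv.ofBijective_apply, thetaTerm, Fin.val_zero, Nat.cast_zero, add_zero]
      calc _ = x ^ (i + j) * y ^ (i - j) * p ^ (binomTwo (i + j) + binomTwo (i - j)) := by
            rw [zpow_add₀ hp]; ring
        _ = _ := by
            rw [he, zpow_add₀ hp, zpow_add₀ hp, zpow_add₀ hx, zpow_sub₀ hy, zpow_mul, zpow_mul,
              mul_zpow, div_zpow, mul_zpow]
            norm_cast
            ring
    · refine tsum_congr fun t => ?_
      obtain ⟨i, j⟩ := t
      have e1 := two_mul_binomTwo (i + j + 1)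
      have e2 := two_mul_binomTwo (i - j)
      have e3 := two_mul_binomTwo i
      have e4 := two_mul_binomTwo j
      have he : binomTwo (i + j + 1) + binomTwo (i - j) =
          2 * binomTwo i + i + 2 * j + 2 * binomTwo j := by
        linarith
      simp only [Equiv.ofBijective_apply, thetaTerm, Fin.val_one, Nat.cast_one]
      calc _ = x ^ (i + j + 1) * y ^ (i - j) * p ^ (binomTwo (i + j + 1) + binomTwo (i - j)) := by
            rw [zpow_add₀ hp]; ring
        _ = _ := by
            rw [he, zpow_add₀ hp, zpow_add₀ hp, zpow_add₀ hp, zpow_add₀ hx, zpow_add₀ hx,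
              zpow_sub₀ hy, zpow_mul, zpow_mul, zpow_mul, zpow_one,
              mul_zpow, mul_zpow, div_zpow, mul_zpow]
            norm_cast
            ring
  · exact (Equiv.summable_iff (Equiv.ofBijective _ bijective_parity_split)).mpr hsum

/-! ### The Rogers–Ramanujan theta series and the dissection of their product. -/

/-- The theta series `∑ (-1) ^ n * q ^ (n (5 n - 3) / 2)`. -/
noncomputable def rrNum (q : ℂ) : ℂ := thetaSeries (-q) (q ^ 5)

/-- The theta series `∑ (-1) ^ n * q ^ (n (5 n - 1) / 2)`. -/
noncomputable def rrDen (q : ℂ) : ℂ := thetaSeries (-q ^ 2) (q ^ 5)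

theorem norm_pow_lt_one {q : ℂ} (hq1 : ‖q‖ < 1) {n : ℕ} (hn : n ≠ 0) : ‖q ^ n‖ < 1 := by
  rw [norm_pow]; exact pow_lt_one₀ (norm_nonneg _) hq1 hn

theorem tendsto_mul_nat_atTop {k : ℕ} (hk : 0 < k) : Tendsto (fun N : ℕ => k * N) atTop atTop :=
  tendsto_id.const_mul_atTop' hk

/-- By the triple product, N collects the factors 1 - q^m with m ≡ 0, 1, 4 modulo 5 and D those with
m ≡ 0, 2, 3. Only the class 0 is repeated. -/
theorem rrNum_mul_rrDen {q : ℂ} (hq : q ≠ 0) (hq1 : ‖q‖ < 1) :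
    rrNum q * rrDen q = eulerProd q * eulerProd (q ^ 5) := by
  have hq5 : ‖q ^ 5‖ < 1 := norm_pow_lt_one hq1 (by norm_num)
  have h1 := (tendsto_triple_product (neg_ne_zero.mpr hq) (pow_ne_zero 5 hq) hq5).mul
    (tendsto_triple_product (neg_ne_zero.mpr (pow_ne_zero 2 hq)) (pow_ne_zero 5 hq) hq5)
  have h2 := ((tendsto_eulerPartial hq1).comp (tendsto_mul_nat_atTop (k := 5) (by norm_num))).mul
    (tendsto_eulerPartial hq5)
  refine tendsto_nhds_unique h1 (h2.congr fun N => ?_)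
  simp only [Function.comp_apply]
  rw [mul_mul_mul_comm, ← Finset.prod_mul_distrib, mul_right_comm]
  rw [mul_comm (eulerPartial q _), mul_assoc]
  congr 1
  induction N with
  | zero => simp [eulerPartial]
  | succ N ih =>
    simp only [eulerPartial] at ih ⊢
    rw [show 5 * (N + 1) = 5 * N + 1 + 1 + 1 + 1 + 1 by ring]
    simp only [Finset.prod_range_succ _ (5 * N + _), Finset.prod_range_succ _ (5 * N),
      Finset.prod_range_succ _ N, ih]
    generalize ∏ i ∈ Finset.range N, (1 - (q ^ 5) ^ (i + 1)) = u
    generalize ∏ i ∈ Finset.range N, ((_ : ℂ) * (_ : ℂ)) = v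
    field_simp
    ring

/-- The vectors (2, -1) and (1, 2) are orthogonal of squared length 5 and span a lattice of index 5,
with cosets represented by (c, c) and detected by 2m - n modulo 5. -/
theorem bijective_quintic_split :
    Function.Bijective fun t : Fin 5 × ℤ × ℤ =>
      (2 * t.2.1 + t.2.2 + (t.1 : ℕ), 2 * t.2.2 - t.2.1 + (t.1 : ℕ)) := by
  constructor
  · rintro ⟨c, i, j⟩ ⟨c', i', j'⟩ h
    simp only [Prod.mk.injEq] at h
    have hc := c.isLt
    have hc' := c'.isLt
    simp only [Prod.mk.injEq, Fin.ext_iff]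
    omega
  · rintro ⟨m, n⟩
    refine ⟨(⟨((2 * m - n) % 5).toNat, by omega⟩, (2 * m - n) / 5,
      m - 2 * ((2 * m - n) / 5) - (2 * m - n) % 5), ?_⟩
    simp only [Prod.mk.injEq]
    omega

/-- The part of `∑ (-1) ^ n * x ^ (n (n - 1) / 2)` with `n` congruent to `c` modulo `5`. -/
noncomputable def thetaResidue (x : ℂ) (c : ℤ) : ℂ := ∑' i : ℤ, thetaTerm (-1) x (5 * i + c)

theorem thetaResidue_add_five (x : ℂ) (c : ℤ) : thetaResidue x (c + 5) = thetaResidue x c := by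
  rw [thetaResidue, thetaResidue,
    ← (Equiv.addRight (1 : ℤ)).tsum_eq fun i => thetaTerm (-1) x (5 * i + c)]
  refine tsum_congr fun i => ?_
  rw [Equiv.coe_addRight, show 5 * (i + 1) + c = 5 * i + (c + 5) by ring]

/-- The reflection n ↦ 1 - n preserves n(n - 1)/2 and reverses (-1)^n. Since it fixes the class 3
modulo 5, that part will vanish. -/
theorem thetaResidue_one_sub (x : ℂ) (c : ℤ) : thetaResidue x (1 - c) = -thetaResidue x c := by
  rw [thetaResidue, thetaResidue, ← (Equiv.neg ℤ).tsum_eq fun i => thetaTerm (-1) x (5 * i + (1 - c)),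
    ← tsum_neg]
  refine tsum_congr fun i => ?_
  have h : binomTwo (5 * -i + (1 - c)) = binomTwo (5 * i + c) := by
    linarith [two_mul_binomTwo (5 * -i + (1 - c)), two_mul_binomTwo (5 * i + c)]
  rw [Equiv.neg_apply, thetaTerm, thetaTerm, h,
    show 5 * -i + (1 - c) = 1 + -(5 * i + c) by ring, zpow_add₀ (by norm_num), zpow_one, zpow_neg,
    ← inv_zpow]
  norm_num

theorem neg_one_zpow_five_mul (i : ℤ) : (-1 : ℂ) ^ (5 * i) = (-1) ^ i := by
  rw [zpow_mul]; norm_num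

theorem thetaResidue_zero {x : ℂ} (hx : x ≠ 0) : thetaResidue x 0 = rrDen (x ^ 5) := by
  refine tsum_congr fun i => ?_
  have h : binomTwo (5 * i + 0) = 10 * i + 25 * binomTwo i := by
    linarith [two_mul_binomTwo (5 * i + 0), two_mul_binomTwo i]
  rw [thetaTerm, thetaTerm, h, zpow_add₀ hx, zpow_mul, zpow_mul, add_zero, neg_one_zpow_five_mul,
    ← neg_one_mul ((x ^ 5) ^ 2), mul_zpow]
  simp only [zpow_ofNat, ← pow_mul]
  ring

theorem thetaResidue_neg_one {x : ℂ} (hx : x ≠ 0) :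
    thetaResidue x (-1) = -(x * rrNum (x ^ 5)) := by
  rw [rrNum, thetaSeries, ← tsum_mul_left, ← tsum_neg]
  refine tsum_congr fun i => ?_
  have h : binomTwo (5 * i + -1) = 1 + 5 * i + 25 * binomTwo i := by
    linarith [two_mul_binomTwo (5 * i + -1), two_mul_binomTwo i]
  rw [thetaTerm, thetaTerm, h, zpow_add₀ hx, zpow_add₀ hx, zpow_mul, zpow_mul,
    zpow_add₀ (by norm_num : (-1 : ℂ) ≠ 0), neg_one_zpow_five_mul,
    ← neg_one_mul (x ^ 5), mul_zpow, show (-1 : ℂ) ^ (-1 : ℤ) = -1 by norm_num]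
  simp only [zpow_ofNat, ← pow_mul]
  ring

/-- The quintic substitution turns the double series into the sum over c of the products A_c A_(3c),
where A_c is the part with index ≡ c modulo 5. By reflection A_0 = -A_1 = D(x^5), A_2 = -A_4 = x
N(x^5) and A_3 = 0. Divided by x N(x^5) D(x^5), the right side is 1/R - 1 - R at x^5. -/
theorem rrNum_mul_rrDen_eq_dissection {x : ℂ} (hx : x ≠ 0) (hx1 : ‖x‖ < 1) :
    rrNum x * rrDen x = rrDen (x ^ 5) ^ 2 - x * (rrNum (x ^ 5) * rrDen (x ^ 5)) -
      x ^ 2 * rrNum (x ^ 5) ^ 2 := by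
  have hx5 : ‖x ^ 5‖ < 1 := norm_pow_lt_one hx1 (by norm_num)
  have h1 := summable_norm_thetaTerm (neg_ne_zero.mpr hx) (pow_ne_zero 5 hx) hx5
  have h2 := summable_norm_thetaTerm (neg_ne_zero.mpr (pow_ne_zero 2 hx)) (pow_ne_zero 5 hx) hx5
  have hsum := summable_mul_of_summable_norm h1 h2
  have hs : ∀ c : ℤ, Summable fun i : ℤ => ‖thetaTerm (-1) x (5 * i + c)‖ := fun c =>
    (summable_norm_thetaTerm (by norm_num) hx hx1).comp_injective
      (i := fun i : ℤ => 5 * i + c) fun i j h => by simpa using h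
  have key : rrNum x * rrDen x =
      ∑ c : Fin 5, thetaResidue x (c : ℕ) * thetaResidue x (3 * (c : ℕ)) := by
    simp only [rrNum, rrDen, thetaSeries, thetaResidue]
    rw [tsum_mul_tsum_of_summable_norm h1 h2,
      ← (Equiv.ofBijective _ bijective_quintic_split).tsum_eq, Summable.tsum_prod, tsum_fintype]
    · refine Finset.sum_congr rfl fun c _ => ?_
      rw [tsum_mul_tsum_of_summable_norm (hs _) (hs _)]
      refine tsum_congr fun t => ?_
      obtain ⟨i, j⟩ := t
      simp only [Equiv.ofBijective_apply]
      generalize ((c : ℕ) : ℤ) = d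
      have he : (2 * i + j + d) + 5 * binomTwo (2 * i + j + d) +
          (2 * (2 * j - i + d) + 5 * binomTwo (2 * j - i + d)) =
          binomTwo (5 * i + d) + binomTwo (5 * j + 3 * d) := by
        linarith [two_mul_binomTwo (2 * i + j + d), two_mul_binomTwo (2 * j - i + d),
          two_mul_binomTwo (5 * i + d), two_mul_binomTwo (5 * j + 3 * d)]
      have hsgn : (-1 : ℂ) ^ (5 * i + d) * (-1) ^ (5 * j + 3 * d) =
          (-1) ^ (2 * i + j + d) * (-1) ^ (2 * j - i + d) := by
        rw [← zpow_add₀ (by norm_num), ← zpow_add₀ (by norm_num),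
          show 5 * i + d + (5 * j + 3 * d) = (2 * i + j + d + (2 * j - i + d)) + 2 * (2 * i + j + d)
            by ring, zpow_add₀ (by norm_num), zpow_mul]
        norm_num
      calc _ = (-1 : ℂ) ^ (2 * i + j + d) * (-1) ^ (2 * j - i + d) *
            x ^ ((2 * i + j + d) + 5 * binomTwo (2 * i + j + d) +
              (2 * (2 * j - i + d) + 5 * binomTwo (2 * j - i + d))) := by
            rw [zpow_add₀ hx, zpow_add₀ hx _ (5 * _), zpow_add₀ hx _ (5 * _), zpow_mul, zpow_mul,
              zpow_mul, thetaTerm, thetaTerm, ← neg_one_mul x, ← neg_one_mul (x ^ 2), mul_zpow,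
              mul_zpow]
            norm_cast
            ring
        _ = _ := by
            rw [he, ← hsgn, zpow_add₀ hx, thetaTerm, thetaTerm]
            ring
    · exact (Equiv.summable_iff (Equiv.ofBijective _ bijective_quintic_split)).mpr hsum
  have e1 : thetaResidue x 1 = -thetaResidue x 0 := by simpa using thetaResidue_one_sub x 0
  have e3 : thetaResidue x 3 = 0 := by
    have h := thetaResidue_one_sub x 3
    have h' := thetaResidue_add_five x (-2)
    norm_num at h h'
    rw [← h'] at h
    exact self_eq_neg.mp h
  have e2 : thetaResidue x 2 = -thetaResidue x (-1) := by
    simpa using thetaResidue_one_sub x (-1)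
  have e4 : thetaResidue x 4 = thetaResidue x (-1) := by
    simpa using thetaResidue_add_five x (-1)
  have e6 : thetaResidue x 6 = thetaResidue x 1 := by
    simpa using thetaResidue_add_five x 1
  have e12 : thetaResidue x 12 = thetaResidue x 2 := by
    have h := thetaResidue_add_five x 7
    have h' := thetaResidue_add_five x 2
    norm_num at h h'
    rw [h, h']
  rw [key]
  simp only [Fin.sum_univ_five]
  norm_num [e1, e2, e3, e4, e6, e12, thetaResidue_zero hx, thetaResidue_neg_one hx]
  ring

/-! ### Products over the fifth roots of unity and the icosahedral form. -/

theorem IsPrimitiveRoot.prod_sub_pow_mul_five {ζ : ℂ} (hζ : IsPrimitiveRoot ζ 5) (b c : ℂ) :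
    ∏ k ∈ Finset.range 5, (b - ζ ^ k * c) = b ^ 5 - c ^ 5 := by
  have hs := hζ.geom_sum_eq_zero (by norm_num)
  simp only [Finset.sum_range_succ, Finset.prod_range_succ, Finset.sum_range_zero,
    Finset.prod_range_zero] at hs ⊢
  linear_combination (-b ^ 4 * c + b ^ 3 * c ^ 2 * (ζ + ζ ^ 3) - b ^ 2 * c ^ 3 * (ζ ^ 3 + ζ ^ 5)
    + b * c ^ 4 * ζ ^ 6 - c ^ 5 * (ζ - 1) * (ζ ^ 5 + 1)) * hs

theorem prod_one_sub_rotated_pow {ζ : ℂ} (hζ : IsPrimitiveRoot ζ 5) (x : ℂ) {m : ℕ}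
    (hm : m.Coprime 5) :
    ∏ k ∈ Finset.range 5, (1 - (ζ ^ k * x) ^ m) = 1 - (x ^ 5) ^ m := by
  rw [← pow_mul, mul_comm 5 m, pow_mul, ← one_pow (M := ℂ) 5,
    ← (hζ.pow_of_coprime m hm).prod_sub_pow_mul_five, one_pow]
  refine Finset.prod_congr rfl fun k _ => ?_
  rw [mul_pow, ← pow_mul, ← pow_mul, mul_comm k]

/-- Factors whose exponent m is prime to 5 multiply to 1 - x^(5m); those with m = 5n are unaffected
by the rotation and contribute (1 - x^(5n))^5. The Euler product at x^25 restores the missing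
multiples of 5. -/
theorem prod_eulerProd_rotated {ζ x : ℂ} (hζ : IsPrimitiveRoot ζ 5) (hx1 : ‖x‖ < 1) :
    (∏ k ∈ Finset.range 5, eulerProd (ζ ^ k * x)) * eulerProd ((x ^ 5) ^ 5) =
      eulerProd (x ^ 5) ^ 6 := by
  have hx5 : ‖x ^ 5‖ < 1 := norm_pow_lt_one hx1 (by norm_num)
  have hx25 : ‖(x ^ 5) ^ 5‖ < 1 := norm_pow_lt_one hx5 (by norm_num)
  have hk : ∀ k, ‖ζ ^ k * x‖ < 1 := fun k => by
    rwa [norm_mul, norm_pow, hζ.norm'_eq_one (by norm_num), one_pow, one_mul]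
  have h5 := tendsto_mul_nat_atTop (k := 5) (by norm_num)
  have h1 := (tendsto_finsetProd (Finset.range 5) fun k _ =>
    (tendsto_eulerPartial (hk k)).comp h5).mul (tendsto_eulerPartial hx25)
  have h2 := ((tendsto_eulerPartial hx5).comp h5).mul ((tendsto_eulerPartial hx5).pow 5)
  rw [pow_succ' (eulerProd (x ^ 5)) 5]
  refine tendsto_nhds_unique h1 (h2.congr fun N => ?_)
  simp only [Function.comp_apply, eulerPartial]
  rw [Finset.prod_comm]
  induction N with
  | zero => simp
  | succ N ih =>
    have hb : ∏ k ∈ Finset.range 5, (1 - (ζ ^ k * x) ^ (5 * N + 1 + 1 + 1 + 1 + 1)) =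
        (1 - (x ^ 5) ^ (N + 1)) ^ 5 := by
      rw [show 5 * N + 1 + 1 + 1 + 1 + 1 = 5 * (N + 1) by ring]
      simp_rw [pow_mul, mul_pow, ← pow_mul, mul_comm _ 5, pow_mul, hζ.pow_eq_one, one_pow, one_mul]
      rw [Finset.prod_const, Finset.card_range]
    have hc : ∀ j, j % 5 ≠ 0 → j.Coprime 5 := fun j hj =>
      Nat.Coprime.symm ((Nat.Prime.coprime_iff_not_dvd Nat.prime_five).mpr
        fun h => hj (Nat.mod_eq_zero_of_dvd h))
    rw [show 5 * (N + 1) = 5 * N + 1 + 1 + 1 + 1 + 1 by ring]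
    simp only [Finset.prod_range_succ _ (5 * N + _), Finset.prod_range_succ _ (5 * N),
      Finset.prod_range_succ _ N]
    rw [hb, prod_one_sub_rotated_pow hζ x (hc _ (by omega)),
      prod_one_sub_rotated_pow hζ x (hc _ (by omega)),
      prod_one_sub_rotated_pow hζ x (hc _ (by omega)),
      prod_one_sub_rotated_pow hζ x (hc _ (by omega)), mul_pow]
    have : ((x ^ 5) ^ 5) ^ (N + 1) = (x ^ 5) ^ (5 * N + 1 + 1 + 1 + 1 + 1) := by ring
    rw [this]
    linear_combination ((1 - (x ^ 5) ^ (5 * N + 1)) * (1 - (x ^ 5) ^ (5 * N + 1 + 1)) *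
      (1 - (x ^ 5) ^ (5 * N + 1 + 1 + 1)) * (1 - (x ^ 5) ^ (5 * N + 1 + 1 + 1 + 1)) *
      (1 - (x ^ 5) ^ (5 * N + 1 + 1 + 1 + 1 + 1)) * (1 - (x ^ 5) ^ (N + 1)) ^ 5) * ih

/-- The icosahedral form in the two Rogers-Ramanujan theta series as a quotient of Euler
products. -/
theorem icosahedral_form_eq {q : ℂ} (hq : q ≠ 0) (hq1 : ‖q‖ < 1) :
    (rrDen q ^ 10 - 11 * q * (rrNum q * rrDen q) ^ 5 - q ^ 2 * rrNum q ^ 10) *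
      eulerProd (q ^ 5) = eulerProd q ^ 11 := by
  obtain ⟨x, rfl⟩ := IsAlgClosed.exists_pow_nat_eq q (n := 5) (by norm_num)
  have hx : x ≠ 0 := by rintro rfl; simp at hq
  have hx1 : ‖x‖ < 1 := by
    rw [norm_pow] at hq1
    exact (pow_lt_one_iff_of_nonneg (norm_nonneg _) (by norm_num)).mp hq1
  have hζ := Complex.isPrimitiveRoot_exp 5 (by norm_num)
  generalize Complex.exp (2 * π * Complex.I / (5 : ℕ)) = ζ at hζ
  have hk : ∀ k, ‖ζ ^ k * x‖ < 1 := fun k => by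
    rwa [norm_mul, norm_pow, hζ.norm'_eq_one (by norm_num), one_pow, one_mul]
  have hk0 : ∀ k, ζ ^ k * x ≠ 0 := fun k =>
    mul_ne_zero (pow_ne_zero _ (hζ.ne_zero (by norm_num))) hx
  have hk5 : ∀ k, (ζ ^ k * x) ^ 5 = x ^ 5 := fun k => by
    rw [mul_pow, ← pow_mul, mul_comm k, pow_mul, hζ.pow_eq_one, one_pow, one_mul]
  set a := rrNum (x ^ 5)
  set b := rrDen (x ^ 5)
  -- Adjoining φ, with conjugate 1 - g, factors the dissected form b² - xab - x²a² into linear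
  -- factors, whose product over rotations is then a difference of fifth powers.
  obtain ⟨g, hg⟩ : ∃ g : ℂ, g ^ 2 = g + 1 := ⟨(φ : ℂ), by exact_mod_cast goldenRatio_sq⟩
  have key : ∀ k, eulerProd (ζ ^ k * x) * eulerProd (x ^ 5) =
      (b - ζ ^ k * (g * x * a)) * (b - ζ ^ k * ((1 - g) * x * a)) := fun k => by
    have h1 := rrNum_mul_rrDen (hk0 k) (hk k)
    have h2 := rrNum_mul_rrDen_eq_dissection (hk0 k) (hk k)
    rw [hk5] at h1 h2
    rw [← h1, h2]
    linear_combination (ζ ^ k * x) ^ 2 * a ^ 2 * hg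
  have hp := Finset.prod_congr (rfl : Finset.range 5 = _) fun k _ => key k
  rw [Finset.prod_mul_distrib, Finset.prod_mul_distrib, hζ.prod_sub_pow_mul_five,
    hζ.prod_sub_pow_mul_five, Finset.prod_const, Finset.card_range] at hp
  -- The coefficient 11 is g^5 + (1 - g)^5, and the product of these two fifth powers is -1.
  have g5 : g ^ 5 = 5 * g + 3 := by linear_combination (g ^ 3 + g ^ 2 + 2 * g + 3) * hg
  have g5' : (1 - g) ^ 5 = 8 - 5 * g := by
    linear_combination (-g ^ 3 + 4 * g ^ 2 - 7 * g + 7) * hg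
  have hpoly : (b ^ 5 - (g * x * a) ^ 5) * (b ^ 5 - ((1 - g) * x * a) ^ 5) =
      b ^ 10 - 11 * x ^ 5 * (a * b) ^ 5 - (x ^ 5) ^ 2 * a ^ 10 := by
    rw [mul_pow, mul_pow, mul_pow ((1 - g) * x), mul_pow (1 - g), g5, g5']
    linear_combination -25 * (x ^ 5) ^ 2 * a ^ 10 * hg
  rw [← hpoly, ← hp]
  linear_combination eulerProd (x ^ 5) ^ 5 * prod_eulerProd_rotated hζ hx1

/-! ### Convergence of the continued fraction. -/

/-- A nonnegative solution of `X (n + 2) = X (n + 1) + q ^ (n + 1) * X n` converges, and its limit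
is determined by a positive solution `y` of the adjoint recurrence with limit `c`. -/
theorem tendsto_of_recurrence {q c : ℝ} (hq0 : 0 < q) (hq1 : q < 1) (hc : 0 < c) {y X : ℕ → ℝ}
    (hy : ∀ k, y k = y (k + 1) + q ^ (k + 1) * y (k + 2)) (hy0 : ∀ k, 0 < y k)
    (hyc : Tendsto y atTop (𝓝 c)) (hX0 : ∀ n, 0 ≤ X n)
    (hX : ∀ n, X (n + 2) = X (n + 1) + q ^ (n + 1) * X n) :
    Tendsto X atTop (𝓝 ((X 1 * y 1 + q * X 0 * y 2) / c)) := by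
  set L := X 1 * y 1 + q * X 0 * y 2 with hL
  -- A discrete Wronskian: pairing a solution with a solution of the adjoint recurrence gives a
  -- conserved quantity. Its second term tends to 0, since `hle` bounds X, so X converges to L / c.
  have inv : ∀ n, X (n + 1) * y (n + 1) + q ^ (n + 1) * X n * y (n + 2) = L := by
    intro n
    induction n with
    | zero => simp [hL]
    | succ n ih =>
      rw [← ih, hX n, hy (n + 1)]
      ring
  have hle : ∀ n, X (n + 1) ≤ L / y (n + 1) := fun n => by
    rw [le_div_iff₀ (hy0 _), ← inv n]
    have := mul_nonneg (mul_nonneg (pow_pos hq0 (n + 1)).le (hX0 n)) (hy0 (n + 2)).le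
    linarith
  have s1 : Tendsto (fun n => y (n + 1)) atTop (𝓝 c) := hyc.comp (tendsto_add_atTop_nat 1)
  have s2 : Tendsto (fun n => y (n + 2)) atTop (𝓝 c) := hyc.comp (tendsto_add_atTop_nat 2)
  have s3 : Tendsto (fun n => y (n + 3)) atTop (𝓝 c) := hyc.comp (tendsto_add_atTop_nat 3)
  have hpow : Tendsto (fun n : ℕ => q ^ (n + 2)) atTop (𝓝 0) :=
    (tendsto_pow_atTop_nhds_zero_of_lt_one hq0.le hq1).comp (tendsto_add_atTop_nat 2)
  have hsmall : Tendsto (fun n => q ^ (n + 2) * X (n + 1) * y (n + 3)) atTop (𝓝 0) := by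
    have hb : Tendsto (fun n => q ^ (n + 2) * (L / y (n + 1)) * y (n + 3)) atTop (𝓝 0) := by
      simpa using (hpow.mul ((tendsto_const_nhds (x := L)).div s1 hc.ne')).mul s3
    refine squeeze_zero (fun n => ?_) (fun n => ?_) hb
    · exact mul_nonneg (mul_nonneg (pow_pos hq0 _).le (hX0 _)) (hy0 _).le
    · have := hle n
      have := (hy0 (n + 3)).le
      gcongr
  have h2 : Tendsto (fun n => X (n + 2)) atTop (𝓝 (L / c)) := by
    have := ((tendsto_const_nhds (x := L)).sub hsmall).div s2 hc.ne'
    rw [sub_zero] at this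
    refine this.congr fun n => ?_
    rw [Pi.div_apply, div_eq_iff (hy0 _).ne', ← inv (n + 1)]
    ring
  exact (tendsto_add_atTop_iff_nat 2).mp h2

theorem rrContFract_get? (a q : ℝ) (n : ℕ) :
    (rrContFract a q).s.get? n = some ⟨if n = 0 then a else q ^ n, 1⟩ := rfl

/-- Numerators start with 0, a and denominators with 1, 1, and both obey the recurrence. Their
conserved quantities are a y₁ and y₁ + q y₂ = y₀; the common limit c cancels in the quotient. -/
theorem tendsto_rrContFract_convs {a q c : ℝ} (ha : 0 ≤ a) (hq0 : 0 < q) (hq1 : q < 1)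
    (hc : 0 < c) {y : ℕ → ℝ} (hy : ∀ k, y k = y (k + 1) + q ^ (k + 1) * y (k + 2))
    (hy0 : ∀ k, 0 < y k) (hyc : Tendsto y atTop (𝓝 c)) :
    Tendsto (rrContFract a q).convs atTop (𝓝 (a * (y 1 / y 0))) := by
  set g := rrContFract a q with hg
  have hn0 : g.nums 0 = 0 := by simp [hg, rrContFract]
  have hd0 : g.dens 0 = 1 := by simp
  have hn1 : g.nums 1 = a := by
    rw [GenContFract.first_num_eq (rrContFract_get? a q 0)]; simp [rrContFract]
  have hd1 : g.dens 1 = 1 := by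
    rw [GenContFract.first_den_eq (rrContFract_get? a q 0)]
  have hn : ∀ n, g.nums (n + 2) = g.nums (n + 1) + q ^ (n + 1) * g.nums n := fun n => by
    rw [GenContFract.nums_recurrence (rrContFract_get? a q (n + 1)) rfl rfl]; simp [hg]
  have hd : ∀ n, g.dens (n + 2) = g.dens (n + 1) + q ^ (n + 1) * g.dens n := fun n => by
    rw [GenContFract.dens_recurrence (rrContFract_get? a q (n + 1)) rfl rfl]; simp [hg]
  have hpos : ∀ X : ℕ → ℝ, 0 ≤ X 0 → 0 ≤ X 1 →
      (∀ n, X (n + 2) = X (n + 1) + q ^ (n + 1) * X n) → ∀ n, 0 ≤ X n := by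
    intro X h0 h1 h n
    have : 0 ≤ X n ∧ 0 ≤ X (n + 1) := by
      induction n with
      | zero => exact ⟨h0, h1⟩
      | succ n ih =>
        refine ⟨ih.2, ?_⟩
        rw [h]
        have := mul_nonneg (pow_pos hq0 (n + 1)).le ih.1
        linarith [ih.2]
    exact this.1
  have t1 := tendsto_of_recurrence hq0 hq1 hc hy hy0 hyc
    (hpos _ hn0.ge (hn1.symm ▸ ha) hn) hn
  have t2 := tendsto_of_recurrence hq0 hq1 hc hy hy0 hyc
    (hpos _ (by simp [hd0]) (by simp [hd1]) hd) hd
  rw [hn0, hn1] at t1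
  have e : g.dens 1 * y 1 + q * g.dens 0 * y 2 = y 0 := by rw [hd0, hd1, hy 0]; ring
  rw [e] at t2
  have h := t1.div t2 (div_pos (hy0 0) hc).ne'
  have hexp : (a * y 1 + q * 0 * y 2) / c / (y 0 / c) = a * (y 1 / y 0) := by
    have := (hy0 0).ne'
    field_simp
    ring
  rwa [hexp] at h

/-! ### Rogers' functional equations and the value of the fraction. -/

/-- The auxiliary terms `(-1) ^ r * a ^ (2 r) * q ^ (5 r (r - 1) / 2) * (a; q)_r / (q; q)_r`. -/
noncomputable def rrTerm (q a : ℝ) (r : ℕ) : ℝ :=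
  (-1) ^ r * a ^ (2 * r) * q ^ (5 * r.choose 2) *
    ∏ i ∈ Finset.range r, ((1 - a * q ^ i) / (1 - q ^ (i + 1)))

/-- The first auxiliary series of Rogers. -/
noncomputable def rogersOne (q a : ℝ) : ℝ := ∑' r : ℕ, rrTerm q a r * (q ^ (2 * r) * (1 - a * q ^ (2 * r)))

/-- The second auxiliary series of Rogers. -/
noncomputable def rogersTwo (q a : ℝ) : ℝ := ∑' r : ℕ, rrTerm q a r * (q ^ r * (1 - a ^ 2 * q ^ (4 * r)))

theorem one_sub_real_pow_pos {q : ℝ} (hq0 : 0 < q) (hq1 : q < 1) (n : ℕ) : 0 < 1 - q ^ (n + 1) :=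
  sub_pos.mpr (pow_lt_one₀ hq0.le hq1 n.succ_ne_zero)

theorem rrTerm_succ {q : ℝ} (hq0 : 0 < q) (hq1 : q < 1) (a : ℝ) (r : ℕ) :
    rrTerm q a (r + 1) * (1 - q ^ (r + 1)) = -(a ^ 2 * q ^ (5 * r) * (1 - a * q ^ r)) * rrTerm q a r := by
  have := (one_sub_real_pow_pos hq0 hq1 r).ne'
  rw [rrTerm, rrTerm, Finset.prod_range_succ, Nat.choose_succ_succ' r 1, Nat.choose_one_right]
  field_simp
  ring

theorem rrTerm_mul (q a : ℝ) (r : ℕ) :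
    (1 - a) * rrTerm q (a * q) r = q ^ (2 * r) * (1 - a * q ^ r) * rrTerm q a r := by
  have h : (1 - a) * ∏ i ∈ Finset.range r, ((1 - a * q * q ^ i) / (1 - q ^ (i + 1))) =
      (1 - a * q ^ r) * ∏ i ∈ Finset.range r, ((1 - a * q ^ i) / (1 - q ^ (i + 1))) := by
    rw [Finset.prod_div_distrib, Finset.prod_div_distrib, ← mul_div_assoc, ← mul_div_assoc,
      mul_comm (1 - a * q ^ r), ← Finset.prod_range_succ, Finset.prod_range_succ', mul_comm (1 - a)]
    simp [pow_succ', mul_assoc]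
  rw [rrTerm, rrTerm, mul_pow]
  linear_combination (-1) ^ r * (a ^ (2 * r) * q ^ (2 * r)) * q ^ (5 * r.choose 2) * h

theorem norm_eulerPartial_ofReal {q : ℝ} (hq0 : 0 < q) (hq1 : q < 1) (n : ℕ) :
    ‖eulerPartial (q : ℂ) n‖ = ∏ i ∈ Finset.range n, (1 - q ^ (i + 1)) := by
  rw [eulerPartial, norm_prod]
  refine Finset.prod_congr rfl fun i _ => ?_
  rw [← abs_of_pos (one_sub_real_pow_pos hq0 hq1 i), ← Real.norm_eq_abs, ← Complex.norm_real]
  push_cast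
  rfl

theorem norm_ofReal_lt_one {q : ℝ} (hq0 : 0 < q) (hq1 : q < 1) : ‖(q : ℂ)‖ < 1 := by
  rwa [Complex.norm_real, Real.norm_of_nonneg hq0.le]

theorem exists_abs_rrTerm_le {q : ℝ} (hq0 : 0 < q) (hq1 : q < 1) :
    ∃ C, 0 ≤ C ∧ ∀ a, 0 ≤ a → a ≤ 1 → ∀ r, |rrTerm q a r| ≤ C := by
  obtain ⟨C, hC0, hC⟩ := exists_norm_eulerPartialInv_le (norm_ofReal_lt_one hq0 hq1)
  refine ⟨C, hC0, fun a ha0 ha1 r => ?_⟩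
  have hE : ∏ i ∈ Finset.range r, (1 / (1 - q ^ (i + 1))) ≤ C := by
    have := hC r
    rw [eulerPartialInv, if_neg (by omega), Int.toNat_natCast, norm_inv,
      norm_eulerPartial_ofReal hq0 hq1] at this
    simpa using this
  have h1 : |∏ i ∈ Finset.range r, ((1 - a * q ^ i) / (1 - q ^ (i + 1)))| ≤ C := by
    refine le_trans ?_ hE
    rw [Finset.abs_prod]
    refine Finset.prod_le_prod (fun _ _ => abs_nonneg _) fun i _ => ?_
    have hp := one_sub_real_pow_pos hq0 hq1 i
    have h2 : a * q ^ i ≤ 1 := mul_le_one₀ ha1 (by positivity) (pow_le_one₀ hq0.le hq1.le)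
    have h3 : 0 ≤ a * q ^ i := by positivity
    rw [abs_div, abs_of_pos hp, abs_of_nonneg (by linarith)]
    gcongr
    linarith
  rw [rrTerm, abs_mul, abs_mul, abs_mul, abs_pow, abs_neg, abs_one, one_pow, one_mul]
  calc _ ≤ 1 * 1 * C := by
        gcongr
        · rw [abs_of_nonneg (by positivity)]; exact pow_le_one₀ ha0 ha1
        · rw [abs_of_nonneg (by positivity)]; exact pow_le_one₀ hq0.le hq1.le
    _ = C := by ring

theorem summable_rrTerm_mul {q : ℝ} (hq0 : 0 < q) (hq1 : q < 1) {a : ℝ} (ha0 : 0 ≤ a) (ha1 : a ≤ 1) {u : ℕ → ℝ} {D : ℝ}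
    (hu : ∀ r, |u r| ≤ D * q ^ r) : Summable fun r => rrTerm q a r * u r := by
  obtain ⟨C, hC0, hC⟩ := exists_abs_rrTerm_le hq0 hq1
  refine Summable.of_norm_bounded (g := fun r => C * (D * q ^ r))
    (((summable_geometric_of_lt_one hq0.le hq1).mul_left D).mul_left C) fun r => ?_
  rw [norm_mul]
  exact mul_le_mul (hC a ha0 ha1 r) (hu r) (norm_nonneg _) hC0

theorem abs_pow_mul_le {q : ℝ} (hq0 : 0 < q) (hq1 : q < 1) {m r : ℕ} {w D : ℝ} (hm : r ≤ m) (hw : |w| ≤ D) :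
    |q ^ m * w| ≤ D * q ^ r := by
  rw [abs_mul, abs_of_pos (pow_pos hq0 m), mul_comm]
  exact mul_le_mul hw (pow_le_pow_of_le_one hq0.le hq1.le hm) (pow_pos hq0 m).le
    ((abs_nonneg _).trans hw)

theorem abs_one_sub_mul_pow_le {q : ℝ} (hq0 : 0 < q) (hq1 : q < 1) {a : ℝ} (ha0 : 0 ≤ a) (ha1 : a ≤ 1) (m : ℕ) :
    |1 - a * q ^ m| ≤ 1 := by
  have h2 : a * q ^ m ≤ 1 := mul_le_one₀ ha1 (by positivity) (pow_le_one₀ hq0.le hq1.le)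
  have h3 : 0 ≤ a * q ^ m := by positivity
  rw [abs_of_nonneg (by linarith)]
  linarith

/-- The factor 1 - q^r kills the term r = 0 and cancels the last denominator of the others, so the
index can be lowered by one. -/
theorem tsum_shift_eq {q : ℝ} (hq0 : 0 < q) (hq1 : q < 1) {a : ℝ} (ha0 : 0 ≤ a) (ha1 : a ≤ 1) {e : ℕ} (he : 1 ≤ e) :
    ∑' r : ℕ, rrTerm q a r * (q ^ (e * r) * (1 - q ^ r)) =
      ∑' r : ℕ, rrTerm q a r * (q ^ (5 * r + e * (r + 1)) * (-(a ^ 2 * (1 - a * q ^ r)))) := by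
  have hs : Summable fun r : ℕ => rrTerm q a r * (q ^ (e * r) * (1 - q ^ r)) :=
    summable_rrTerm_mul hq0 hq1 ha0 ha1 (D := 1) fun r =>
      abs_pow_mul_le hq0 hq1 (Nat.le_mul_of_pos_left r he)
        (by simpa using abs_one_sub_mul_pow_le hq0 hq1 zero_le_one le_rfl r)
  rw [hs.tsum_eq_zero_add]
  simp only [pow_zero, sub_self, mul_zero, zero_add]
  refine tsum_congr fun r => ?_
  rw [pow_add]
  linear_combination q ^ (e * (r + 1)) * rrTerm_succ hq0 hq1 a r

/-- Write q^(2r)(1 - a q^(2r)) = q^(2r)(1 - q^r) + q^(3r)(1 - a q^r) and shift the first part. The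
common factor 1 - a q^r then converts a into aq by `rrTerm_mul`. -/
theorem rogersOne_eq {q : ℝ} (hq0 : 0 < q) (hq1 : q < 1) {a : ℝ} (ha0 : 0 ≤ a) (ha1 : a ≤ 1) :
    rogersOne q a = (1 - a) * rogersTwo q (a * q) := by
  have habs := abs_one_sub_mul_pow_le hq0 hq1 ha0 ha1
  have hsA : Summable fun r : ℕ => rrTerm q a r * (q ^ (2 * r) * (1 - q ^ r)) :=
    summable_rrTerm_mul hq0 hq1 ha0 ha1 (D := 1) fun r => abs_pow_mul_le hq0 hq1 (by omega)
      (by simpa using abs_one_sub_mul_pow_le hq0 hq1 zero_le_one le_rfl r)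
  have hsB : Summable fun r : ℕ => rrTerm q a r * (q ^ (3 * r) * (1 - a * q ^ r)) :=
    summable_rrTerm_mul hq0 hq1 ha0 ha1 (D := 1) fun r => abs_pow_mul_le hq0 hq1 (by omega) (habs r)
  have hsC : Summable fun r : ℕ => rrTerm q a r *
      (q ^ (5 * r + 2 * (r + 1)) * (-(a ^ 2 * (1 - a * q ^ r)))) :=
    summable_rrTerm_mul hq0 hq1 ha0 ha1 (D := 1) fun r => abs_pow_mul_le hq0 hq1 (by omega) (by
      rw [abs_neg, abs_mul, abs_of_nonneg (by positivity)]
      exact mul_le_one₀ (pow_le_one₀ ha0 ha1) (abs_nonneg _) (habs r))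
  calc rogersOne q a = ∑' r : ℕ, (rrTerm q a r * (q ^ (2 * r) * (1 - q ^ r)) +
        rrTerm q a r * (q ^ (3 * r) * (1 - a * q ^ r))) := tsum_congr fun r => by ring
    _ = ∑' r : ℕ, (rrTerm q a r * (q ^ (5 * r + 2 * (r + 1)) * (-(a ^ 2 * (1 - a * q ^ r)))) +
        rrTerm q a r * (q ^ (3 * r) * (1 - a * q ^ r))) := by
        rw [hsA.tsum_add hsB, hsC.tsum_add hsB, tsum_shift_eq hq0 hq1 ha0 ha1 (by norm_num)]
    _ = _ := by
        rw [rogersTwo, ← tsum_mul_left]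
        refine tsum_congr fun r => ?_
        rw [← mul_assoc (1 - a), rrTerm_mul]
        ring

/-- The same shift applies, now starting from the difference of weights q^r(1 - q^r) + a q^(4r)(1 -
a q^r). -/
theorem rogersTwo_sub_rogersOne {q : ℝ} (hq0 : 0 < q) (hq1 : q < 1) {a : ℝ} (ha0 : 0 ≤ a) (ha1 : a ≤ 1) :
    rogersTwo q a - rogersOne q a = (1 - a) * a * rogersOne q (a * q) := by
  have habs := abs_one_sub_mul_pow_le hq0 hq1 ha0 ha1
  have hs1 : Summable fun r : ℕ => rrTerm q a r * (q ^ (2 * r) * (1 - a * q ^ (2 * r))) :=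
    summable_rrTerm_mul hq0 hq1 ha0 ha1 (D := 1) fun r => abs_pow_mul_le hq0 hq1 (by omega) (habs _)
  have hs2 : Summable fun r : ℕ => rrTerm q a r * (q ^ r * (1 - a ^ 2 * q ^ (4 * r))) :=
    summable_rrTerm_mul hq0 hq1 ha0 ha1 (D := 1) fun r => abs_pow_mul_le hq0 hq1 le_rfl
      (abs_one_sub_mul_pow_le hq0 hq1 (by positivity) (pow_le_one₀ ha0 ha1) _)
  have hsA : Summable fun r : ℕ => rrTerm q a r * (q ^ (1 * r) * (1 - q ^ r)) :=
    summable_rrTerm_mul hq0 hq1 ha0 ha1 (D := 1) fun r => abs_pow_mul_le hq0 hq1 (by omega)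
      (by simpa using abs_one_sub_mul_pow_le hq0 hq1 zero_le_one le_rfl r)
  have hsB : Summable fun r : ℕ => rrTerm q a r * (q ^ (4 * r) * (a * (1 - a * q ^ r))) :=
    summable_rrTerm_mul hq0 hq1 ha0 ha1 (D := 1) fun r => abs_pow_mul_le hq0 hq1 (by omega) (by
      rw [abs_mul, abs_of_nonneg ha0]
      exact mul_le_one₀ ha1 (abs_nonneg _) (habs r))
  have hsC : Summable fun r : ℕ => rrTerm q a r *
      (q ^ (5 * r + 1 * (r + 1)) * (-(a ^ 2 * (1 - a * q ^ r)))) :=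
    summable_rrTerm_mul hq0 hq1 ha0 ha1 (D := 1) fun r => abs_pow_mul_le hq0 hq1 (by omega) (by
      rw [abs_neg, abs_mul, abs_of_nonneg (by positivity)]
      exact mul_le_one₀ (pow_le_one₀ ha0 ha1) (abs_nonneg _) (habs r))
  rw [rogersTwo, rogersOne, ← hs2.tsum_sub hs1]
  calc _ = ∑' r : ℕ, (rrTerm q a r * (q ^ (1 * r) * (1 - q ^ r)) +
        rrTerm q a r * (q ^ (4 * r) * (a * (1 - a * q ^ r)))) := tsum_congr fun r => by ring
    _ = ∑' r : ℕ, (rrTerm q a r * (q ^ (5 * r + 1 * (r + 1)) * (-(a ^ 2 * (1 - a * q ^ r)))) +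
        rrTerm q a r * (q ^ (4 * r) * (a * (1 - a * q ^ r)))) := by
        rw [hsA.tsum_add hsB, hsC.tsum_add hsB, tsum_shift_eq hq0 hq1 ha0 ha1 le_rfl]
    _ = _ := by
        rw [rogersOne, ← tsum_mul_left]
        refine tsum_congr fun r => ?_
        rw [mul_comm (1 - a) a, mul_assoc a, ← mul_assoc (1 - a), rrTerm_mul]
        ring

theorem rogersTwo_recurrence {q : ℝ} (hq0 : 0 < q) (hq1 : q < 1) {a : ℝ} (ha0 : 0 ≤ a) (ha1 : a ≤ 1) :
    rogersTwo q a = (1 - a) * rogersTwo q (a * q) +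
      a * (1 - a) * (1 - a * q) * rogersTwo q (a * q * q) := by
  have h1 := rogersTwo_sub_rogersOne hq0 hq1 ha0 ha1
  rw [rogersOne_eq hq0 hq1 ha0 ha1, rogersOne_eq hq0 hq1 (by positivity)
    (mul_le_one₀ ha1 hq0.le hq1.le)] at h1
  linear_combination h1

theorem tendsto_rogersTwo {q : ℝ} (hq0 : 0 < q) (hq1 : q < 1) : Tendsto (fun k : ℕ => rogersTwo q (q ^ (k + 1))) atTop (𝓝 1) := by
  obtain ⟨C, hC0, hC⟩ := exists_abs_rrTerm_le hq0 hq1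
  have h0 : rogersTwo q 0 = 1 := by
    rw [rogersTwo, tsum_eq_single 0]
    · simp [rrTerm]
    · intro r hr
      simp [rrTerm, hr]
  rw [← h0]
  have hpow : Tendsto (fun k : ℕ => q ^ (k + 1)) atTop (𝓝 0) :=
    (tendsto_pow_atTop_nhds_zero_of_lt_one hq0.le hq1).comp (tendsto_add_atTop_nat 1)
  refine tendsto_tsum_of_dominated_convergence (bound := fun r : ℕ => C * (1 * q ^ r))
    (((summable_geometric_of_lt_one hq0.le hq1).mul_left 1).mul_left C) (fun r => ?_)
    (Eventually.of_forall fun k r => ?_)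
  · have hcont : Continuous fun a => rrTerm q a r * (q ^ r * (1 - a ^ 2 * q ^ (4 * r))) := by
      unfold rrTerm
      fun_prop
    exact (hcont.tendsto 0).comp hpow
  · have ha0 : 0 ≤ q ^ (k + 1) := by positivity
    have ha1 : q ^ (k + 1) ≤ 1 := pow_le_one₀ hq0.le hq1.le
    rw [norm_mul]
    exact mul_le_mul (hC _ ha0 ha1 r) (abs_pow_mul_le hq0 hq1 le_rfl
      (abs_one_sub_mul_pow_le hq0 hq1 (by positivity) (pow_le_one₀ ha0 ha1) _))
      (norm_nonneg _) hC0

theorem rrTerm_self {q : ℝ} (hq0 : 0 < q) (hq1 : q < 1) (r : ℕ) : rrTerm q q r = (-1) ^ r * q ^ (2 * r) * q ^ (5 * r.choose 2) := by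
  rw [rrTerm, Finset.prod_eq_one, mul_one]
  intro i _
  rw [← pow_succ']
  exact div_self (one_sub_real_pow_pos hq0 hq1 i).ne'

theorem binomTwo_natCast (r : ℕ) : binomTwo r = (r.choose 2 : ℕ) := by
  have h := Nat.choose_two_right r
  rcases r with _ | r
  · rfl
  · rw [h, binomTwo]
    push_cast
    simp

/-- Splitting a theta series at the origin. -/
theorem thetaSeries_eq_tsum_nat {z p : ℂ} (hz : z ≠ 0) (hp : p ≠ 0) (hp1 : ‖p‖ < 1) :
    thetaSeries z p = ∑' r : ℕ, (thetaTerm z p r + thetaTerm (p / z) p (r + 1)) := by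
  have h1 := (summable_thetaTerm_nat hz hp hp1).of_norm
  have h2 : Summable fun r : ℕ => thetaTerm (p / z) p (r + 1) := by
    have h := (summable_thetaTerm_nat (div_ne_zero hp hz) hp hp1).of_norm
    exact_mod_cast (summable_nat_add_iff 1).mpr h
  rw [h1.tsum_add h2, thetaSeries, tsum_of_nat_of_neg_add_one h1]
  · simp only [thetaTerm_neg hp]
  · simpa only [thetaTerm_neg hp] using h2

/-- At a = q the finite products cancel, and the r-th term collects the theta terms of indices r and
-(r + 1). Passing from -q to -q^4 by the symmetry of the theta series makes this grouping termwise.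
-/
theorem rogersOne_self {q : ℝ} (hq0 : 0 < q) (hq1 : q < 1) :
    ((rogersOne q q : ℝ) : ℂ) = rrNum q := by
  have hq : (q : ℂ) ≠ 0 := by exact_mod_cast hq0.ne'
  have hp1 : ‖(q : ℂ) ^ 5‖ < 1 := norm_pow_lt_one (norm_ofReal_lt_one hq0 hq1) (by norm_num)
  have hz : (-q ^ 4 : ℂ) ≠ 0 := neg_ne_zero.mpr (pow_ne_zero 4 hq)
  have hdiv : (q : ℂ) ^ 5 / (-q ^ 4) = -q := by field_simp
  have hp := pow_ne_zero 5 hq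
  rw [rrNum, ← hdiv, thetaSeries_div hp, thetaSeries_eq_tsum_nat hz hp hp1, hdiv, rogersOne,
    Complex.ofReal_tsum]
  refine tsum_congr fun r => ?_
  rw [thetaTerm_succ (neg_ne_zero.mpr hq) hp, thetaTerm, thetaTerm, binomTwo_natCast,
    rrTerm_self hq0 hq1]
  simp only [zpow_natCast]
  push_cast
  rw [neg_pow, neg_pow (q : ℂ)]
  ring

theorem rogersTwo_self {q : ℝ} (hq0 : 0 < q) (hq1 : q < 1) :
    ((rogersTwo q q : ℝ) : ℂ) = rrDen q := by
  have hq : (q : ℂ) ≠ 0 := by exact_mod_cast hq0.ne'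
  have hp1 : ‖(q : ℂ) ^ 5‖ < 1 := norm_pow_lt_one (norm_ofReal_lt_one hq0 hq1) (by norm_num)
  have hz : (-q ^ 3 : ℂ) ≠ 0 := neg_ne_zero.mpr (pow_ne_zero 3 hq)
  have hdiv : (q : ℂ) ^ 5 / (-q ^ 3) = -q ^ 2 := by field_simp
  have hp := pow_ne_zero 5 hq
  rw [rrDen, ← hdiv, thetaSeries_div hp, thetaSeries_eq_tsum_nat hz hp hp1, hdiv, rogersTwo,
    Complex.ofReal_tsum]
  refine tsum_congr fun r => ?_
  rw [thetaTerm_succ (neg_ne_zero.mpr (pow_ne_zero 2 hq)) hp, thetaTerm, thetaTerm,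
    binomTwo_natCast, rrTerm_self hq0 hq1]
  simp only [zpow_natCast]
  push_cast
  rw [neg_pow, neg_pow ((q : ℂ) ^ 2)]
  ring

/-- The continued fraction converges to the quotient of the two series of Rogers, which are
positive. -/
theorem rogers_pos_and_tendsto_convs {q : ℝ} (hq0 : 0 < q) (hq1 : q < 1) :
    0 < rogersOne q q ∧ 0 < rogersTwo q q ∧ ∀ a : ℝ, 0 ≤ a →
      Tendsto (rrContFract a q).convs atTop (𝓝 (a * (rogersOne q q / rogersTwo q q))) := by
  have hn := norm_ofReal_lt_one hq0 hq1
  set E : ℕ → ℝ := fun k => ∏ i ∈ Finset.range k, (1 - q ^ (i + 1)) with hE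
  set y : ℕ → ℝ := fun k => rogersTwo q (q ^ (k + 1)) * E k with hy
  have hEs : ∀ k, E (k + 1) = E k * (1 - q ^ (k + 1)) := fun k => Finset.prod_range_succ _ _
  have hc : 0 < ‖eulerProd (q : ℂ)‖ := norm_pos_iff.mpr (eulerProd_ne_zero hn)
  have hyc : Tendsto y atTop (𝓝 ‖eulerProd (q : ℂ)‖) := by
    have h := (tendsto_rogersTwo hq0 hq1).mul (tendsto_eulerPartial hn).norm
    simpa only [one_mul, norm_eulerPartial_ofReal hq0 hq1] using h
  have hrec : ∀ k, y k = y (k + 1) + q ^ (k + 1) * y (k + 2) := fun k => by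
    have h := rogersTwo_recurrence hq0 hq1 (a := q ^ (k + 1)) (by positivity)
      (pow_le_one₀ hq0.le hq1.le)
    simp only [hy, hEs, ← pow_succ] at h ⊢
    rw [h]
    ring
  -- Positivity holds far out because the limit is positive, and the recurrence, read backwards, has
  -- positive coefficients.
  have hpos : ∀ k, 0 < y k := by
    obtain ⟨K, hK⟩ := eventually_atTop.mp (hyc.eventually (lt_mem_nhds hc))
    have h : ∀ j k, K ≤ k + j → 0 < y k := by
      intro j
      induction j with
      | zero => exact fun k hk => hK k hk
      | succ j ih =>
        intro k hk
        rw [hrec]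
        exact add_pos (ih _ (by omega)) (mul_pos (pow_pos hq0 _) (ih _ (by omega)))
    exact fun k => h K k (by omega)
  have h0 : y 0 = rogersTwo q q := by simp [hy, hE]
  have h1 : y 1 = rogersOne q q := by
    rw [rogersOne_eq hq0 hq1 hq0.le hq1.le]
    simp [hy, hE, pow_two, mul_comm]
  refine ⟨h1 ▸ hpos 1, h0 ▸ hpos 0, fun a ha => ?_⟩
  rw [← h0, ← h1]
  exact tendsto_rrContFract_convs ha hq0 hq1 hc hrec hpos hyc

/-- The continued fraction `1 / (1 + q / (1 + q ^ 2 / ⋯))`. -/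
noncomputable def rrRatio (q : ℝ) : ℝ := rogersOne q q / rogersTwo q q

theorem tendsto_rrR {q : ℝ} (hq0 : 0 < q) (hq1 : q < 1) :
    Tendsto (rrContFract (q ^ (1 / 5 : ℝ)) q).convs atTop (𝓝 (q ^ (1 / 5 : ℝ) * rrRatio q)) :=
  (rogers_pos_and_tendsto_convs hq0 hq1).2.2 _ (rpow_nonneg hq0.le _)

theorem rrR_eq {q : ℝ} (hq0 : 0 < q) (hq1 : q < 1) : rrR q = q ^ (1 / 5 : ℝ) * rrRatio q :=
  (tendsto_rrR hq0 hq1).limUnder_eq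

theorem rrR_pos {q : ℝ} (hq0 : 0 < q) (hq1 : q < 1) : 0 < rrR q := by
  obtain ⟨h1, h2, -⟩ := rogers_pos_and_tendsto_convs hq0 hq1
  rw [rrR_eq hq0 hq1]
  exact mul_pos (rpow_pos_of_pos hq0 _) (div_pos h1 h2)

theorem ofReal_rrRatio {q : ℝ} (hq0 : 0 < q) (hq1 : q < 1) :
    ((rrRatio q : ℝ) : ℂ) = rrNum q / rrDen q := by
  rw [rrRatio, Complex.ofReal_div, rogersOne_self hq0 hq1, rogersTwo_self hq0 hq1]

theorem rrNum_ofReal_ne_zero {q : ℝ} (hq0 : 0 < q) (hq1 : q < 1) : rrNum q ≠ 0 := by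
  rw [← rogersOne_self hq0 hq1]
  exact_mod_cast (rogers_pos_and_tendsto_convs hq0 hq1).1.ne'

theorem rrDen_ofReal_ne_zero {q : ℝ} (hq0 : 0 < q) (hq1 : q < 1) : rrDen q ≠ 0 := by
  rw [← rogersTwo_self hq0 hq1]
  exact_mod_cast (rogers_pos_and_tendsto_convs hq0 hq1).2.1.ne'

/-! ### Poisson summation and the first reciprocity formula. -/

theorem thetaTerm_five_mul_add {z p : ℂ} (hz : z ≠ 0) (hp : p ≠ 0) (k d : ℤ) :
    thetaTerm z p (5 * k + d) =
      thetaTerm z p d * thetaTerm (z ^ 5 * p ^ (10 + 5 * d)) (p ^ 25) k := by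
  have h : binomTwo (5 * k + d) = binomTwo d + (10 + 5 * d) * k + 25 * binomTwo k := by
    linarith [two_mul_binomTwo (5 * k + d), two_mul_binomTwo d, two_mul_binomTwo k]
  rw [thetaTerm, thetaTerm, thetaTerm, h, zpow_add₀ hz, zpow_add₀ hp, zpow_add₀ hp, zpow_mul,
    zpow_mul, zpow_mul, mul_zpow]
  simp only [zpow_ofNat]
  ring

theorem thetaSeries_mul_right {z p : ℂ} (hz : z ≠ 0) (hp : p ≠ 0) :
    z * thetaSeries (z * p) p = thetaSeries z p := by
  rw [thetaSeries, thetaSeries, ← (Equiv.addRight (1 : ℤ)).tsum_eq (thetaTerm z p),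
    ← tsum_mul_left]
  refine tsum_congr fun n => ?_
  rw [Equiv.coe_addRight, thetaTerm_succ hz hp, thetaTerm, thetaTerm, mul_zpow]
  ring

/-- At z = -1, quasi-periodicity and the symmetry z ↦ p / z give values of opposite sign. -/
theorem thetaSeries_neg_self {p : ℂ} (hp : p ≠ 0) : thetaSeries (-p) p = 0 := by
  have h1 := thetaSeries_mul_right (z := -1) (by norm_num) hp
  have h2 := thetaSeries_div (z := -1) hp
  rw [neg_one_mul, neg_one_mul] at h1
  rw [div_neg, div_one] at h2
  rw [← h1] at h2
  exact self_eq_neg.mp h2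

theorem bijective_residue_split :
    Function.Bijective fun t : Fin 5 × ℤ => 5 * t.2 + ((t.1 : ℕ) : ℤ) := by
  constructor
  · rintro ⟨c, i⟩ ⟨c', i'⟩ h
    have hc := c.isLt
    have hc' := c'.isLt
    simp only [Prod.mk.injEq, Fin.ext_iff] at h ⊢
    omega
  · intro n
    refine ⟨(⟨(n % 5).toNat, by omega⟩, n / 5), ?_⟩
    simp only
    omega

/-- The dissection modulo `5` of a theta series at a fifth root of `-1`. -/
theorem thetaSeries_dissection {z p : ℂ} (hz : z ^ 5 = -1) (hp : p ≠ 0) (hp1 : ‖p‖ < 1) :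
    thetaSeries z p = (1 + z) * rrDen (p ^ 5) + (z ^ 2 + z⁻¹) * p * rrNum (p ^ 5) := by
  have hz0 : z ≠ 0 := by rintro rfl; norm_num at hz
  have hP : p ^ 5 ≠ 0 := pow_ne_zero 5 hp
  have hsum := summable_thetaTerm hz0 hp hp1
  -- Classes 0 and 1 give multiples of D(p^5), classes 2 and 4 multiples of N(p^5), and class 3
  -- vanishes by `thetaSeries_neg_self`.
  have key : thetaSeries z p = ∑ d : Fin 5, thetaTerm z p (d : ℕ) *
      thetaSeries (-p ^ (10 + 5 * (d : ℕ))) (p ^ 25) := by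
    rw [thetaSeries, ← (Equiv.ofBijective _ bijective_residue_split).tsum_eq, Summable.tsum_prod,
      tsum_fintype]
    · refine Finset.sum_congr rfl fun d _ => ?_
      rw [thetaSeries, ← tsum_mul_left]
      refine tsum_congr fun k => ?_
      rw [Equiv.ofBijective_apply, thetaTerm_five_mul_add hz0 hp, hz, neg_one_mul]
      norm_cast
    · exact hsum.comp_injective (Equiv.ofBijective _ bijective_residue_split).injective
  have e1 : thetaSeries (-p ^ 15) (p ^ 25) = rrDen (p ^ 5) := by
    rw [rrDen, ← thetaSeries_div (pow_ne_zero 5 hP)]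
    congr 1
    · field_simp
    · ring
  have e2 : thetaSeries (-p ^ 20) (p ^ 25) = rrNum (p ^ 5) := by
    rw [rrNum, ← thetaSeries_div (pow_ne_zero 5 hP)]
    congr 1
    · field_simp
    · ring
  have e0 : thetaSeries (-p ^ 10) (p ^ 25) = rrDen (p ^ 5) := by
    rw [rrDen]; ring_nf
  have e4 : -p ^ 5 * thetaSeries (-p ^ 30) (p ^ 25) = rrNum (p ^ 5) := by
    rw [rrNum, ← thetaSeries_mul_right (neg_ne_zero.mpr hP) (pow_ne_zero 5 hP)]
    ring_nf
  have e4' : thetaSeries (-p ^ 30) (p ^ 25) = -rrNum (p ^ 5) / p ^ 5 := by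
    rw [← e4]; field_simp
  have b0 : binomTwo 0 = 0 := by linarith [two_mul_binomTwo 0]
  have b1 : binomTwo 1 = 0 := by linarith [two_mul_binomTwo 1]
  have b2 : binomTwo 2 = 1 := by linarith [two_mul_binomTwo 2]
  have b3 : binomTwo 3 = 3 := by linarith [two_mul_binomTwo 3]
  have b4 : binomTwo 4 = 6 := by linarith [two_mul_binomTwo 4]
  rw [key, Fin.sum_univ_five]
  norm_num [thetaTerm, b0, b1, b2, b3, b4, e0, e1, e2, e4',
    thetaSeries_neg_self (pow_ne_zero 25 hp), zpow_ofNat]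
  field_simp
  linear_combination (-p * rrNum (p ^ 5)) * hz

/-- The Poisson summation formula for the theta series with real nome. -/
theorem thetaSeries_poisson {α β : ℝ} (hα : 0 < α) (hαβ : α * β = π ^ 2) (c : ℝ) :
    thetaSeries (-Complex.exp (-((5 - c) * α))) (Complex.exp (-(10 * α))) =
      1 / (5 * α / π : ℂ) ^ (1 / 2 : ℂ) *
        (Complex.exp (c ^ 2 * α / 20 - β / 20 + c * π * Complex.I / 10) *
          thetaSeries (Complex.exp (-(c * π * Complex.I / 5))) (Complex.exp (-(2 * β / 5)))) := by
  have hπ : (π : ℂ) ≠ 0 := by exact_mod_cast pi_ne_zero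
  have hα' : (α : ℂ) ≠ 0 := by exact_mod_cast hα.ne'
  have hβ : (β : ℂ) = π ^ 2 / α := by
    rw [eq_div_iff hα', mul_comm]; exact_mod_cast hαβ
  have hre : 0 < (5 * α / π : ℂ).re := by
    have : (5 * α / π : ℂ) = ((5 * α / π : ℝ) : ℂ) := by push_cast; rfl
    rw [this, Complex.ofReal_re]
    positivity
  -- The general term on the left is exp(-5αn² + (cα + πi)n), whence the two parameters. The cases c
  -- = 1 and c = 3 are D and N.
  have h := Complex.tsum_exp_neg_quadratic hre ((c * α + π * Complex.I) / (2 * π))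
  have hb : ∀ n : ℤ, (2 : ℂ) * (binomTwo n : ℂ) = n * (n - 1) := fun n => by
    exact_mod_cast two_mul_binomTwo n
  convert h using 1
  · refine tsum_congr fun n => ?_
    rw [thetaTerm, ← neg_one_mul, mul_zpow, ← Complex.exp_int_mul, ← Complex.exp_int_mul,
      ← Complex.exp_pi_mul_I, ← Complex.exp_int_mul, ← Complex.exp_add, ← Complex.exp_add]
    congr 1
    field_simp
    linear_combination (-5 * (α : ℂ)) * hb n
  · congr 1
    rw [thetaSeries, ← tsum_mul_left]
    refine tsum_congr fun n => ?_
    rw [thetaTerm, ← Complex.exp_int_mul, ← Complex.exp_int_mul, ← Complex.exp_add,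
      ← Complex.exp_add]
    congr 1
    rw [hβ]
    field_simp
    linear_combination (-800 * (π : ℂ) ^ 2) * hb n +
      (200 * π * (4 * π * n + 2 * Complex.I * c * α + π * Complex.I ^ 2 - π) +
        200 * (c * α) ^ 2) * Complex.I_sq

theorem ofReal_rrR_exp {α : ℝ} (hα : 0 < α) :
    ((rrR (exp (-2 * α)) : ℝ) : ℂ) = Complex.exp (-(2 * α / 5)) *
      (rrNum (Complex.exp (-(2 * α))) / rrDen (Complex.exp (-(2 * α)))) := by
  have h1 : exp (-2 * α) < 1 := Real.exp_lt_one_iff.mpr (by linarith)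
  rw [rrR_eq (exp_pos _) h1, Complex.ofReal_mul, ofReal_rrRatio (exp_pos _) h1, ← Real.exp_mul]
  push_cast
  ring_nf

/-- The first reciprocity formula. -/
theorem rrR_reciprocity {α β : ℝ} (hα : 0 < α) (hβ : 0 < β) (hαβ : α * β = π ^ 2) :
    rrR (exp (-2 * α)) = (1 - φ * rrR (exp (-2 * β))) / (φ + rrR (exp (-2 * β))) := by
  set z : ℂ := Complex.exp (-(π * Complex.I / 5)) with hzdef
  set p : ℂ := Complex.exp (-(2 * β / 5)) with hpdef
  have hz0 : z ≠ 0 := Complex.exp_ne_zero _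
  have hp0 : p ≠ 0 := Complex.exp_ne_zero _
  have hp1 : ‖p‖ < 1 := by
    rw [hpdef, Complex.norm_exp]
    refine Real.exp_lt_one_iff.mpr ?_
    simp
    positivity
  have hz5 : z ^ 5 = -1 := by
    rw [hzdef, ← Complex.exp_nat_mul, ← Complex.exp_neg_pi_mul_I]
    congr 1
    push_cast
    ring
  have hz15 : (z ^ 3) ^ 5 = -1 := by rw [← pow_mul, mul_comm, pow_mul, hz5]; norm_num
  have hP : p ^ 5 = Complex.exp (-(2 * β)) := by
    rw [hpdef, ← Complex.exp_nat_mul]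
    congr 1
    push_cast
    ring
  -- The golden ratio enters here as 2 cos(π/5).
  have hφ : z + z⁻¹ = (φ : ℂ) := by
    rw [hzdef, ← Complex.exp_neg]
    have h := Complex.two_cos (π / 5 : ℂ)
    have h2 : Complex.cos (π / 5) = ((cos (π / 5) : ℝ) : ℂ) := by push_cast; rfl
    rw [h2, cos_pi_div_five] at h
    rw [goldenRatio]
    push_cast at h ⊢
    ring_nf at h ⊢
    rw [h]
  set q : ℂ := Complex.exp (-(2 * α)) with hq
  set K : ℂ := 1 / (5 * α / π : ℂ) ^ (1 / 2 : ℂ)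
  have hq1 : -q ^ 2 = -Complex.exp (-((5 - (1 : ℝ)) * α)) := by
    rw [hq, ← Complex.exp_nat_mul]; push_cast; ring_nf
  have hq3 : -q = -Complex.exp (-((5 - (3 : ℝ)) * α)) := by
    rw [hq]; push_cast; ring_nf
  have hq5 : q ^ 5 = Complex.exp (-(10 * α)) := by
    rw [hq, ← Complex.exp_nat_mul]; push_cast; ring_nf
  have hD : rrDen q = K * (Complex.exp (α / 20 - β / 20 + π * Complex.I / 10) *
      thetaSeries z p) := by
    rw [rrDen, hq1, hq5, thetaSeries_poisson hα hαβ 1]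
    simp only [Complex.ofReal_one, one_mul, one_pow]
    rfl
  have hN : rrNum q = K * (Complex.exp (α / 20 - β / 20 + π * Complex.I / 10) *
      (Complex.exp (2 * α / 5) * z⁻¹ * thetaSeries (z ^ 3) p)) := by
    have e1 : Complex.exp (((3 : ℝ) : ℂ) ^ 2 * α / 20 - β / 20 + ((3 : ℝ) : ℂ) * π * Complex.I / 10) =
        Complex.exp (α / 20 - β / 20 + π * Complex.I / 10) * (Complex.exp (2 * α / 5) * z⁻¹) := by
      rw [hzdef, ← Complex.exp_neg, ← Complex.exp_add, ← Complex.exp_add]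
      push_cast
      ring_nf
    have e2 : Complex.exp (-(((3 : ℝ) : ℂ) * π * Complex.I / 5)) = z ^ 3 := by
      rw [hzdef, ← Complex.exp_nat_mul]
      push_cast
      ring_nf
    rw [rrNum, hq3, hq5, thetaSeries_poisson hα hαβ 3, e1, e2]
    ring
  have hq0 : rrDen q ≠ 0 := by
    have := rrDen_ofReal_ne_zero (exp_pos (-2 * α)) (Real.exp_lt_one_iff.mpr (by linarith))
    push_cast at this
    rwa [neg_mul] at this
  have hP0 : rrDen (p ^ 5) ≠ 0 := by
    have := rrDen_ofReal_ne_zero (exp_pos (-2 * β)) (Real.exp_lt_one_iff.mpr (by linarith))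
    push_cast at this
    rwa [neg_mul, ← hP] at this
  have hT0 : thetaSeries z p ≠ 0 := fun h => hq0 (by rw [hD, h, mul_zero, mul_zero])
  have hK : K * Complex.exp (α / 20 - β / 20 + π * Complex.I / 10) ≠ 0 := fun h => hq0 (by
    rw [hD, ← mul_assoc, h, zero_mul])
  have hR : ((rrR (exp (-2 * α)) : ℝ) : ℂ) = z⁻¹ * thetaSeries (z ^ 3) p / thetaSeries z p := by
    rw [ofReal_rrR_exp hα, hN, hD, ← mul_assoc K, ← mul_assoc K, mul_div_mul_left _ _ hK,
      Complex.exp_neg]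
    have := Complex.exp_ne_zero (2 * α / 5)
    field_simp
  have hr : ((rrR (exp (-2 * β)) : ℝ) : ℂ) * rrDen (p ^ 5) = p * rrNum (p ^ 5) := by
    rw [ofReal_rrR_exp hβ, ← hP]
    field_simp
    rfl
  have hr0 := rrR_pos (exp_pos (-2 * β)) (Real.exp_lt_one_iff.mpr (by linarith))
  generalize rrR (exp (-2 * β)) = r at hr hr0 ⊢
  have hφ0 := goldenRatio_pos
  have h1 := thetaSeries_dissection hz5 hp0 hp1
  have h3 := thetaSeries_dissection hz15 hp0 hp1
  have hden : ((φ + r : ℝ) : ℂ) ≠ 0 := by exact_mod_cast (add_pos hφ0 hr0).ne'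
  have hsq : z ^ 2 = φ * z - 1 := by
    rw [← hφ]; field_simp; ring
  have hg : (φ : ℂ) ^ 2 = φ + 1 := by exact_mod_cast goldenRatio_sq
  have hinv : z⁻¹ = φ - z := by rw [← hφ]; ring
  have hinv3 : (z ^ 3)⁻¹ = -z ^ 2 := by
    exact inv_eq_of_mul_eq_one_right (by linear_combination -hz5)
  have hz3 : z ^ 3 = φ * z - φ := by linear_combination (z + φ) * hsq + z * hg
  have hz6 : (φ * z - φ) ^ 2 = -z := by
    rw [← hz3]; linear_combination z * hz5
  -- Modulo z² = φz - 1 and φ² = φ + 1, both theta values acquire the common factor D(p^5)(1 + z)(φ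
  -- - 1), which leaves the Möbius quotient.
  have k1 : thetaSeries z p = rrDen (p ^ 5) * (1 + z) * (φ - 1) * (φ + r) := by
    rw [h1, mul_assoc _ p, ← hr, hinv]
    linear_combination (rrDen (p ^ 5) * (r * (1 : ℂ))) * hsq
      - rrDen (p ^ 5) * (1 + z) * hg
  have k3 : z⁻¹ * thetaSeries (z ^ 3) p = rrDen (p ^ 5) * (1 + z) * (φ - 1) * (1 - φ * r) := by
    rw [h3, mul_assoc _ p, ← hr, hinv3, hinv, hz3, hz6]
    linear_combination (rrDen (p ^ 5) * (-φ + r * (1 + z))) * hsq +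
      rrDen (p ^ 5) * (-1 + r * (1 + z)) * hg
  have hfinal : ((rrR (exp (-2 * α)) : ℝ) : ℂ) = (((1 - φ * r) / (φ + r) : ℝ) : ℂ) := by
    rw [hR, k3, k1]
    rw [k1] at hT0
    rw [mul_div_mul_left _ _ (left_ne_zero_of_mul hT0)]
    push_cast
    rfl
  exact_mod_cast hfinal

/-! ### The eta function and the second reciprocity formula. -/

open ModularForm in
theorem eta_I_mul (t : ℝ) :
    eta (t * Complex.I) = Complex.exp (-(π * t / 12)) * eulerProd (Complex.exp (-(2 * (π * t)))) := by
  have e1 : Function.Periodic.qParam 24 (t * Complex.I) = Complex.exp (-(π * t / 12)) := by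
    rw [Function.Periodic.qParam]
    congr 1
    push_cast
    linear_combination (π * t / 12 : ℂ) * Complex.I_sq
  have e2 : Function.Periodic.qParam 1 (t * Complex.I) = Complex.exp (-(2 * (π * t))) := by
    rw [Function.Periodic.qParam]
    congr 1
    push_cast
    linear_combination (2 * π * t : ℂ) * Complex.I_sq
  rw [eta, e1, eulerProd]
  simp only [eta_q, e2]

-- Squaring the transformation law removes the choice of branch of the square root; only sixth
-- powers of η are needed later.
open ModularForm in
theorem eta_inv_mul_I {t : ℝ} (ht : 0 < t) :
    eta ((t⁻¹ : ℝ) * Complex.I) ^ 2 = t * eta (t * Complex.I) ^ 2 := by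
  have hmem : (t * Complex.I : ℂ) ∈ UpperHalfPlane.upperHalfPlaneSet := by
    simpa [UpperHalfPlane.upperHalfPlaneSet] using ht
  have h := eta_comp_eq_csqrt_I_inv hmem
  have ht' : (t : ℂ) ≠ 0 := by exact_mod_cast ht.ne'
  have e : (-1 / (t * Complex.I) : ℂ) = (t⁻¹ : ℝ) * Complex.I := by
    rw [div_eq_iff (mul_ne_zero ht' Complex.I_ne_zero)]
    push_cast
    field_simp
    linear_combination -Complex.I_sq
  simp only [Function.comp_apply, Pi.smul_apply, Pi.mul_apply, smul_eq_mul] at h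
  rw [e] at h
  have hsq : ∀ w : ℂ, Complex.sqrt w ^ 2 = w := fun w => by
    simp [Complex.sqrt]
  rw [h, mul_pow, mul_pow, inv_pow, hsq, hsq]
  have := Complex.I_ne_zero
  field_simp

open ModularForm in
/-- The fifth power of the continued fraction in terms of the eta function. -/
theorem rrR_pow_five_eta {α : ℝ} (hα : 0 < α) :
    ((1 / rrR (exp (-2 * α)) ^ 5 - 11 - rrR (exp (-2 * α)) ^ 5 : ℝ) : ℂ) *
      eta ((5 * (α / π) : ℝ) * Complex.I) ^ 6 = eta ((α / π : ℝ) * Complex.I) ^ 6 := by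
  have hq1 : exp (-2 * α) < 1 := Real.exp_lt_one_iff.mpr (by linarith)
  have hR := ofReal_rrR_exp hα
  have hπ : (π : ℂ) ≠ 0 := by exact_mod_cast pi_ne_zero
  have hN0 := rrNum_ofReal_ne_zero (exp_pos _) hq1
  have hD0 := rrDen_ofReal_ne_zero (exp_pos _) hq1
  have hn := norm_ofReal_lt_one (exp_pos _) hq1
  have hcast : ((exp (-2 * α) : ℝ) : ℂ) = Complex.exp (-(2 * α)) := by push_cast; ring_nf
  rw [hcast] at hN0 hD0 hn
  rw [eta_I_mul, eta_I_mul]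
  have e1 : Complex.exp (-(2 * (π * ((5 * (α / π) : ℝ) : ℂ)))) = Complex.exp (-(2 * α)) ^ 5 := by
    rw [← Complex.exp_nat_mul]
    congr 1
    push_cast
    field_simp
  have e2 : Complex.exp (-(2 * (π * ((α / π : ℝ) : ℂ)))) = Complex.exp (-(2 * α)) := by
    congr 1
    push_cast
    field_simp
  have e3 : Complex.exp (-(π * ((5 * (α / π) : ℝ) : ℂ) / 12)) ^ 6 =
      Complex.exp (-(π * ((α / π : ℝ) : ℂ) / 12)) ^ 6 * Complex.exp (-(2 * α)) := by
    rw [← Complex.exp_nat_mul, ← Complex.exp_nat_mul, ← Complex.exp_add]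
    congr 1
    push_cast
    field_simp
    ring
  have e4 : Complex.exp (-(2 * α / 5)) ^ 5 = Complex.exp (-(2 * α)) := by
    rw [← Complex.exp_nat_mul]
    congr 1
    push_cast
    field_simp
  rw [e1, e2, mul_pow, mul_pow, e3]
  generalize Complex.exp (-(π * ((α / π : ℝ) : ℂ) / 12)) ^ 6 = w
  have h1 := rrNum_mul_rrDen (Complex.exp_ne_zero _) hn
  have h2 := icosahedral_form_eq (Complex.exp_ne_zero _) hn
  push_cast
  rw [hR, mul_pow, e4]
  have hq0 : Complex.exp (-(2 * α)) ≠ 0 := Complex.exp_ne_zero _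
  have hE := eulerProd_ne_zero hn
  have hE5 := eulerProd_ne_zero (norm_pow_lt_one hn (n := 5) (by norm_num))
  generalize Complex.exp (-(2 * α)) = q at *
  set N := rrNum q
  set D := rrDen q
  have h3 : (1 / (q * (N / D) ^ 5) - 11 - q * (N / D) ^ 5) * q * (N * D) ^ 5 =
      D ^ 10 - 11 * q * (N * D) ^ 5 - q ^ 2 * N ^ 10 := by
    field_simp
  have h4 : (1 / (q * (N / D) ^ 5) - 11 - q * (N / D) ^ 5) * q * eulerProd (q ^ 5) ^ 6 =
      eulerProd q ^ 6 := by
    rw [h1] at h3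
    rw [h1, ← h3] at h2
    refine mul_left_cancel₀ (pow_ne_zero 5 hE) ?_
    linear_combination h2
  linear_combination w * h4

-- With t = α/π the hypothesis reads β/π = 1/(5t), so inversion exchanges the two eta values at α
-- with those at β. The weights (5t)³ and t³ leave 5³ = 125.
open ModularForm in
theorem rrR_pow_five_mul {α β : ℝ} (hα : 0 < α) (hβ : 0 < β) (hαβ : α * β = π ^ 2 / 5) :
    (1 / rrR (exp (-2 * α)) ^ 5 - 11 - rrR (exp (-2 * α)) ^ 5) *
      (1 / rrR (exp (-2 * β)) ^ 5 - 11 - rrR (exp (-2 * β)) ^ 5) = 125 := by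
  have ha := rrR_pow_five_eta hα
  have hb := rrR_pow_five_eta hβ
  have hπ := pi_pos
  have i1 : β / π = (5 * (α / π))⁻¹ := by
    field_simp
    linarith
  have i2 : 5 * (β / π) = (α / π)⁻¹ := by
    rw [i1]; field_simp
  have ht : 0 < α / π := by positivity
  have ht5 : 0 < 5 * (α / π) := by positivity
  have j1 := eta_inv_mul_I ht5
  have j2 := eta_inv_mul_I ht
  rw [← i1] at j1
  rw [← i2] at j2
  have hne : ∀ t : ℝ, 0 < t → eta ((t : ℂ) * Complex.I) ≠ 0 := fun t ht =>
    eta_ne_zero (by simpa [UpperHalfPlane.upperHalfPlaneSet] using ht)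
  have n1 := hne _ ht
  have n2 := hne _ ht5
  have ht' : ((α / π : ℝ) : ℂ) ≠ 0 := by exact_mod_cast ht.ne'
  rw [show eta (((5 * (β / π) : ℝ) : ℂ) * Complex.I) ^ 6 =
      (eta (((5 * (β / π) : ℝ) : ℂ) * Complex.I) ^ 2) ^ 3 by ring,
    show eta (((β / π : ℝ) : ℂ) * Complex.I) ^ 6 =
      (eta (((β / π : ℝ) : ℂ) * Complex.I) ^ 2) ^ 3 by ring, j1, j2] at hb
  have key : ((((1 / rrR (exp (-2 * α)) ^ 5 - 11 - rrR (exp (-2 * α)) ^ 5) *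
      (1 / rrR (exp (-2 * β)) ^ 5 - 11 - rrR (exp (-2 * β)) ^ 5) : ℝ)) : ℂ) = 125 := by
    rw [Complex.ofReal_mul]
    generalize ((1 / rrR (exp (-2 * α)) ^ 5 - 11 - rrR (exp (-2 * α)) ^ 5 : ℝ) : ℂ) = x at *
    generalize ((1 / rrR (exp (-2 * β)) ^ 5 - 11 - rrR (exp (-2 * β)) ^ 5 : ℝ) : ℂ) = y at *
    rw [show ((5 * (α / π) : ℝ) : ℂ) = 5 * ((α / π : ℝ) : ℂ) by push_cast; ring] at *
    generalize ((α / π : ℝ) : ℂ) = t at *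
    generalize eta (t * Complex.I) = u at *
    generalize eta (5 * t * Complex.I) = v at *
    have h3 : y * u ^ 6 = 125 * v ^ 6 := by
      refine mul_left_cancel₀ (pow_ne_zero 3 ht') ?_
      linear_combination hb
    refine mul_right_cancel₀ (mul_ne_zero (pow_ne_zero 6 n1) (pow_ne_zero 6 n2)) ?_
    linear_combination y * u ^ 6 * ha + u ^ 6 * h3
  exact_mod_cast key

theorem rrR_exp_pos {α : ℝ} (hα : 0 < α) : 0 < rrR (exp (-2 * α)) :=
  rrR_pos (exp_pos _) (Real.exp_lt_one_iff.mpr (by linarith))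

/-- First reciprocity gives the bound: 1 - φr < φ + r for r > 0, since φ > 1. -/
theorem rrR_exp_lt_one {α : ℝ} (hα : 0 < α) : rrR (exp (-2 * α)) < 1 := by
  have hβ : 0 < π ^ 2 / α := by positivity
  have h0 := rrR_exp_pos hβ
  rw [rrR_reciprocity hα hβ (by field_simp), div_lt_one (by linarith [goldenRatio_pos])]
  nlinarith [one_lt_goldenRatio]

theorem goldenRatio_pow_five : φ ^ 5 = 5 * φ + 3 := by
  linear_combination (φ ^ 3 + φ ^ 2 + 2 * φ + 3) * goldenRatio_sq

/-- The second reciprocity formula. -/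
theorem rrR_pow_five_reciprocity {α β : ℝ} (hα : 0 < α) (hβ : 0 < β) (hαβ : α * β = π ^ 2 / 5) :
    rrR (exp (-2 * α)) ^ 5 =
      (1 - φ ^ 5 * rrR (exp (-2 * β)) ^ 5) / (φ ^ 5 + rrR (exp (-2 * β)) ^ 5) := by
  have h := rrR_pow_five_mul hα hβ hαβ
  have hu0 := pow_pos (rrR_exp_pos hα) 5
  have hv0 := pow_pos (rrR_exp_pos hβ) 5
  have hu1 := pow_lt_one₀ (rrR_exp_pos hα).le (rrR_exp_lt_one hα) (n := 5) (by norm_num)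
  have hv1 := pow_lt_one₀ (rrR_exp_pos hβ).le (rrR_exp_lt_one hβ) (n := 5) (by norm_num)
  generalize rrR (exp (-2 * α)) ^ 5 = u at *
  generalize rrR (exp (-2 * β)) ^ 5 = v at *
  have hg : (φ ^ 5) ^ 2 = 11 * φ ^ 5 + 1 := by
    rw [goldenRatio_pow_five]; linear_combination 25 * goldenRatio_sq
  have hg0 : 0 < φ ^ 5 := pow_pos goldenRatio_pos 5
  generalize φ ^ 5 = g at *
  have hpoly : (1 - 11 * u - u ^ 2) * (1 - 11 * v - v ^ 2) = 125 * u * v := by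
    field_simp at h
    linear_combination h
  -- The quantity 1/u - 11 - u is invariant under u ↦ -1/u, so the relation contains both u = T(v)
  -- and u = -1/T(v), with T the Möbius map. The second is impossible for u and v in (0, 1).
  have hfac : (u * (g + v) - (1 - g * v)) * (u * (1 - g * v) + (g + v)) = 0 := by
    linear_combination -g * hpoly + (u * (1 - v ^ 2) - (u ^ 2 - 1) * v) * hg
  rw [eq_div_iff (by positivity)]
  rcases mul_eq_zero.mp hfac with h' | h'
  · linarith
  · exfalso
    have h1 : u * (g * v) ≤ g * 1 := by
      calc u * (g * v) ≤ 1 * (g * 1) := by gcongr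
        _ = g * 1 := by ring
    nlinarith

/-! ### The modular equation of degree two. -/

/-- The triple product identity for `z = ε * q ^ k` and nome `q ^ (k + j)`, with `ε = ±1`. -/
theorem tendsto_triple_product_pow {q ε : ℂ} (hq : q ≠ 0) (hq1 : ‖q‖ < 1) (hε : ε ^ 2 = 1)
    {k j m : ℕ} (hm : k + j = m) (hm0 : m ≠ 0) :
    Tendsto (fun N : ℕ => eulerPartial (q ^ m) N *
        ∏ i ∈ Finset.range N, ((1 + ε * q ^ (m * i + k)) * (1 + ε * q ^ (m * i + j))))
      atTop (𝓝 (thetaSeries (ε * q ^ k) (q ^ m))) := by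
  have hε0 : ε ≠ 0 := by rintro rfl; norm_num at hε
  refine (tendsto_triple_product (mul_ne_zero hε0 (pow_ne_zero k hq)) (pow_ne_zero m hq)
    (norm_pow_lt_one hq1 hm0)).congr fun N => ?_
  congr 1
  refine Finset.prod_congr rfl fun i _ => ?_
  have h1 : ε * q ^ k * (q ^ m) ^ i = ε * q ^ (m * i + k) := by ring
  have h2 : (q ^ m) ^ (i + 1) / (ε * q ^ k) = ε * q ^ (m * i + j) := by
    rw [div_eq_iff (mul_ne_zero hε0 (pow_ne_zero k hq)), ← pow_mul,
      show m * (i + 1) = m * i + j + k by rw [← hm]; ring, pow_add _ _ k]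
    linear_combination (-(q ^ (m * i + j) * q ^ k)) * hε
  rw [h1, h2]

/-- By the triple product, either side has the factors 1 - q^m for every class of m modulo 10 except
0 and 5, once each, and the same Euler factors. -/
theorem rrDen_mul_eq_rrNum_mul {q : ℂ} (hq : q ≠ 0) (hq1 : ‖q‖ < 1) :
    rrDen q * (rrDen (q ^ 2) * thetaSeries (-q) (q ^ 10)) =
      rrNum q * (rrNum (q ^ 2) * thetaSeries (-q ^ 3) (q ^ 10)) := by
  have t := fun {k j m : ℕ} => tendsto_triple_product_pow (k := k) (j := j) (m := m) hq hq1
    (ε := -1) (by norm_num)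
  have h2 := tendsto_mul_nat_atTop (k := 2) (by norm_num)
  have l1 := ((t (k := 2) (j := 3) (m := 5) rfl (by norm_num)).comp h2).mul
    ((t (k := 4) (j := 6) (m := 10) rfl (by norm_num)).mul
      (t (k := 1) (j := 9) (m := 10) rfl (by norm_num)))
  have l2 := ((t (k := 1) (j := 4) (m := 5) rfl (by norm_num)).comp h2).mul
    ((t (k := 2) (j := 8) (m := 10) rfl (by norm_num)).mul
      (t (k := 3) (j := 7) (m := 10) rfl (by norm_num)))
  have e1 : (q ^ 2) ^ 5 = q ^ 10 := by ring
  have e2 : (q ^ 2) ^ 2 = q ^ 4 := by ring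
  simp only [neg_one_mul, pow_one] at l1 l2
  rw [rrDen, rrDen, rrNum, rrNum, e1, e2]
  refine tendsto_nhds_unique l1 (l2.congr fun N => ?_)
  simp only [Function.comp_apply]
  have key : (∏ i ∈ Finset.range (2 * N), ((1 + -q ^ (5 * i + 1)) * (1 + -q ^ (5 * i + 4)))) *
      ((∏ i ∈ Finset.range N, ((1 + -q ^ (10 * i + 2)) * (1 + -q ^ (10 * i + 8)))) *
        ∏ i ∈ Finset.range N, ((1 + -q ^ (10 * i + 3)) * (1 + -q ^ (10 * i + 7)))) =
      (∏ i ∈ Finset.range (2 * N), ((1 + -q ^ (5 * i + 2)) * (1 + -q ^ (5 * i + 3)))) *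
      ((∏ i ∈ Finset.range N, ((1 + -q ^ (10 * i + 4)) * (1 + -q ^ (10 * i + 6)))) *
        ∏ i ∈ Finset.range N, ((1 + -q ^ (10 * i + 1)) * (1 + -q ^ (10 * i + 9)))) := by
    induction N with
    | zero => simp
    | succ N ih =>
      rw [show 2 * (N + 1) = 2 * N + 1 + 1 by ring]
      simp only [Finset.prod_range_succ _ (2 * N + 1), Finset.prod_range_succ _ (2 * N),
        Finset.prod_range_succ _ N]
      rw [show 5 * (2 * N + 1) + 1 = 10 * N + 6 by ring,
        show 5 * (2 * N + 1) + 4 = 10 * N + 9 by ring,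
        show 5 * (2 * N + 1) + 2 = 10 * N + 7 by ring,
        show 5 * (2 * N + 1) + 3 = 10 * N + 8 by ring,
        show 5 * (2 * N) = 10 * N by ring]
      linear_combination ((1 + -q ^ (10 * N + 1)) * (1 + -q ^ (10 * N + 2)) *
        (1 + -q ^ (10 * N + 3)) * (1 + -q ^ (10 * N + 4)) * (1 + -q ^ (10 * N + 6)) *
        (1 + -q ^ (10 * N + 7)) * (1 + -q ^ (10 * N + 8)) * (1 + -q ^ (10 * N + 9))) * ih
  linear_combination (eulerPartial (q ^ 5) (2 * N) * eulerPartial (q ^ 10) N ^ 2) * key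

/-- A theta series times its companion with opposite sign. -/
theorem thetaSeries_mul_neg {q : ℂ} (hq : q ≠ 0) (hq1 : ‖q‖ < 1) {k j m : ℕ} (hm : k + j = m)
    (hm0 : m ≠ 0) :
    thetaSeries (q ^ k) (q ^ m) * thetaSeries (-q ^ k) (q ^ m) * eulerProd ((q ^ 2) ^ m) =
      thetaSeries (-(q ^ 2) ^ k) ((q ^ 2) ^ m) * eulerProd (q ^ m) ^ 2 := by
  have hq2 : ‖q ^ 2‖ < 1 := norm_pow_lt_one hq1 two_ne_zero
  have l1 := ((tendsto_triple_product_pow hq hq1 (ε := 1) (by norm_num) hm hm0).mul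
    (tendsto_triple_product_pow hq hq1 (ε := -1) (by norm_num) hm hm0)).mul
    (tendsto_eulerPartial (norm_pow_lt_one hq2 hm0))
  have l2 := (tendsto_triple_product_pow (pow_ne_zero 2 hq) hq2 (ε := -1) (by norm_num) hm hm0).mul
    ((tendsto_eulerPartial (norm_pow_lt_one hq1 hm0)).pow 2)
  simp only [one_mul, neg_one_mul] at l1 l2
  refine tendsto_nhds_unique l1 (l2.congr fun N => ?_)
  have key : (∏ i ∈ Finset.range N, ((1 + -(q ^ 2) ^ (m * i + k)) * (1 + -(q ^ 2) ^ (m * i + j)))) =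
      (∏ i ∈ Finset.range N, ((1 + q ^ (m * i + k)) * (1 + q ^ (m * i + j)))) *
      ∏ i ∈ Finset.range N, ((1 + -q ^ (m * i + k)) * (1 + -q ^ (m * i + j))) := by
    rw [← Finset.prod_mul_distrib]
    refine Finset.prod_congr rfl fun i _ => ?_
    ring
  rw [key]
  ring

/-- The parity splits of θ(q)θ(-q²) and θ(-q)θ(q²) in nome q^5 differ only in one sign. Dividing
them, `thetaSeries_mul_neg` supplies θ(q)/θ(q²), and `rrDen_mul_eq_rrNum_mul` supplies the ratio of
the two theta series of nome q^10 other than N(q²) and D(q²). -/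
theorem thetaSeries_degree_two {q : ℂ} (hq : q ≠ 0) (hq1 : ‖q‖ < 1) (hN : rrNum q ≠ 0)
    (hN2 : rrNum (q ^ 2) ≠ 0) (hD2 : rrDen (q ^ 2) ≠ 0) :
    (rrNum (q ^ 2) * rrDen q ^ 2 - rrDen (q ^ 2) * rrNum q ^ 2) * (rrDen q * rrDen (q ^ 2) ^ 2) =
      q * ((rrNum (q ^ 2) * rrDen q ^ 2 + rrDen (q ^ 2) * rrNum q ^ 2) *
        (rrNum q * rrNum (q ^ 2) ^ 2)) := by
  have hq5 : q ^ 5 ≠ 0 := pow_ne_zero 5 hq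
  have hq51 : ‖q ^ 5‖ < 1 := norm_pow_lt_one hq1 (by norm_num)
  have r1 := rrDen_mul_eq_rrNum_mul hq hq1
  have m1 := thetaSeries_mul_neg hq hq1 (k := 1) (j := 4) (m := 5) rfl (by norm_num)
  have m2 := thetaSeries_mul_neg hq hq1 (k := 2) (j := 3) (m := 5) rfl (by norm_num)
  have s1 := thetaSeries_mul_thetaSeries hq (neg_ne_zero.mpr (pow_ne_zero 2 hq)) hq5 hq51
  have s2 := thetaSeries_mul_thetaSeries (neg_ne_zero.mpr hq) (pow_ne_zero 2 hq) hq5 hq51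
  have p10 : (q ^ 5) ^ 2 = q ^ 10 := by ring
  have e8 : thetaSeries (-q ^ 8) (q ^ 10) = thetaSeries (-q ^ 2) (q ^ 10) := by
    rw [← thetaSeries_div (pow_ne_zero 10 hq)]
    congr 1
    field_simp
  have e9 : thetaSeries (-q ^ 9) (q ^ 10) = thetaSeries (-q) (q ^ 10) := by
    rw [← thetaSeries_div (pow_ne_zero 10 hq)]
    congr 1
    field_simp
  have a1 : q * -q ^ 2 = -q ^ 3 := by ring
  have a2 : q * q ^ 5 / -q ^ 2 = -q ^ 4 := by field_simp
  have a3 : q * -q ^ 2 * q ^ 5 = -q ^ 8 := by ring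
  have a4 : q * q ^ 10 / -q ^ 2 = -q ^ 9 := by field_simp
  have b1 : -q * q ^ 2 = -q ^ 3 := by ring
  have b2 : -q * q ^ 5 / q ^ 2 = -q ^ 4 := by field_simp
  have b3 : -q * q ^ 2 * q ^ 5 = -q ^ 8 := by ring
  have b4 : -q * q ^ 10 / q ^ 2 = -q ^ 9 := by field_simp
  have n2 : rrNum (q ^ 2) = thetaSeries (-q ^ 2) (q ^ 10) := by rw [rrNum]; ring_nf
  have d2 : rrDen (q ^ 2) = thetaSeries (-q ^ 4) (q ^ 10) := by rw [rrDen]; ring_nf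
  rw [p10, a3, a1, a2, a4, e8, e9, ← n2, ← d2] at s1
  rw [p10, b3, b1, b2, b4, e8, e9, ← n2, ← d2] at s2
  rw [pow_one, pow_one] at m1
  rw [show thetaSeries (-q) (q ^ 5) = rrNum q from rfl] at m1 s2
  rw [show thetaSeries (-q ^ 2) (q ^ 5) = rrDen q from rfl] at m2 s1
  rw [show thetaSeries (-q ^ 2) ((q ^ 2) ^ 5) = rrNum (q ^ 2) from rfl] at m1
  rw [show thetaSeries (-(q ^ 2) ^ 2) ((q ^ 2) ^ 5) = rrDen (q ^ 2) from rfl] at m2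
  have hE := eulerProd_ne_zero hq51
  have hE2 := eulerProd_ne_zero (norm_pow_lt_one (norm_pow_lt_one hq1 two_ne_zero)
    (n := 5) (by norm_num))
  generalize rrNum q = a at *
  generalize rrDen q = b at *
  generalize rrNum (q ^ 2) = a' at *
  generalize rrDen (q ^ 2) = b' at *
  generalize thetaSeries (-q) (q ^ 10) = d at *
  generalize thetaSeries (-q ^ 3) (q ^ 10) = c at *
  generalize thetaSeries q (q ^ 5) = u at *
  generalize thetaSeries (q ^ 2) (q ^ 5) = v at *
  generalize eulerProd (q ^ 5) = E at *
  generalize eulerProd ((q ^ 2) ^ 5) = E' at *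
  have hd : d ≠ 0 := by
    rintro rfl
    have hc : c = 0 := by
      have : a * (a' * c) = 0 := by rw [← r1]; ring
      simpa [hN, hN2] using this
    have hv : v = 0 := by
      rw [hc] at s2
      have : a * v = 0 := by rw [s2]; ring
      simpa [hN] using this
    rw [hv] at m2
    have : b' * E ^ 2 = 0 := by rw [← m2]; ring
    simp [hD2, hE] at this
  have hm : a' * b * v = b' * a * u := by
    refine mul_right_cancel₀ (mul_ne_zero hE2 (pow_ne_zero 2 hE)) ?_
    linear_combination a' * E ^ 2 * m2 - b' * E ^ 2 * m1
  refine mul_left_cancel₀ hd ?_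
  linear_combination (a' * b ^ 2 * b' - b' ^ 2 * a ^ 2) * r1 + a ^ 2 * a' * b * hm +
    b' * a ^ 3 * a' * s1 - a' ^ 2 * a * b ^ 2 * s2

/-- The modular equation of degree two. -/
theorem rrR_degree_two {q : ℝ} (hq0 : 0 < q) (hq1 : q < 1) :
    rrR (q ^ 2) - rrR q ^ 2 = (rrR (q ^ 2) + rrR q ^ 2) * (rrR q * rrR (q ^ 2) ^ 2) := by
  have hq20 : 0 < q ^ 2 := by positivity
  have hq21 : q ^ 2 < 1 := pow_lt_one₀ hq0.le hq1 two_ne_zero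
  have hc : (((q ^ 2 : ℝ)) : ℂ) = (q : ℂ) ^ 2 := by push_cast; rfl
  have hq : (q : ℂ) ≠ 0 := by exact_mod_cast hq0.ne'
  have hN := rrNum_ofReal_ne_zero hq0 hq1
  have hD := rrDen_ofReal_ne_zero hq0 hq1
  have hN2 := rrNum_ofReal_ne_zero hq20 hq21
  have hD2 := rrDen_ofReal_ne_zero hq20 hq21
  have r1 := ofReal_rrRatio hq0 hq1
  have r2 := ofReal_rrRatio hq20 hq21
  rw [hc] at hN2 hD2 r2
  have h := thetaSeries_degree_two hq (norm_ofReal_lt_one hq0 hq1) hN hN2 hD2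
  have key : ((rrRatio (q ^ 2) - rrRatio q ^ 2 : ℝ) : ℂ) =
      ((q * ((rrRatio (q ^ 2) + rrRatio q ^ 2) * (rrRatio q * rrRatio (q ^ 2) ^ 2)) : ℝ) : ℂ) := by
    push_cast
    rw [r1, r2]
    field_simp
    linear_combination h
  have keySq := Complex.ofReal_inj.mp key
  rw [rrR_eq hq0 hq1, rrR_eq hq20 hq21]
  have hs : (q ^ 2) ^ (1 / 5 : ℝ) = (q ^ (1 / 5 : ℝ)) ^ 2 := by
    rw [← rpow_natCast, ← rpow_natCast, ← rpow_mul hq0.le, ← rpow_mul hq0.le, mul_comm]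
  have hs5 : (q ^ (1 / 5 : ℝ)) ^ 5 = q := by
    rw [← rpow_natCast, ← rpow_mul hq0.le]; norm_num
  rw [hs]
  generalize q ^ (1 / 5 : ℝ) = s at *
  rw [← hs5] at keySq
  rw [← hs5]
  linear_combination s ^ 2 * keySq

/-! ### Algebra of the special values. -/

/-- The positive fixed point of `u ↦ (1 - g u) / (g + u)`. -/
theorem eq_sqrt_sub_of_fixed {g u : ℝ} (hg : 0 < g) (hu : 0 < u) (h : u = (1 - g * u) / (g + u)) :
    u = √(g ^ 2 + 1) - g := by
  rw [eq_div_iff (by positivity)] at h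
  have : √(g ^ 2 + 1) = u + g := by
    rw [sqrt_eq_iff_mul_self_eq (by positivity) (by positivity)]
    linear_combination -h
  linarith

theorem rpow_one_fifth_pow {x : ℝ} (hx : 0 ≤ x) : (x ^ 5) ^ (1 / 5 : ℝ) = x := by
  rw [← rpow_natCast, ← rpow_mul hx]; norm_num

/-- The first reciprocity formula, in terms of a fifth power given as a fraction. -/
theorem reciprocity_of_pow_five_eq_div {r N D : ℝ} (hr : 0 < r) (hD : 0 < D) (h : r ^ 5 = N / D) :
    (1 - φ * r) / (φ + r) =
      (D ^ (1 / 5 : ℝ) - φ * N ^ (1 / 5 : ℝ)) / (φ * D ^ (1 / 5 : ℝ) + N ^ (1 / 5 : ℝ)) := by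
  have hN : N = r ^ 5 * D := by rw [h]; field_simp
  have hd : 0 < D ^ (1 / 5 : ℝ) := rpow_pos_of_pos hD _
  have hφ := goldenRatio_pos
  rw [hN, mul_rpow (by positivity) hD.le, rpow_one_fifth_pow hr.le]
  have h1 : φ + r ≠ 0 := by positivity
  have h2 : φ * D ^ (1 / 5 : ℝ) + r * D ^ (1 / 5 : ℝ) ≠ 0 := by positivity
  rw [div_eq_div_iff h1 h2]
  ring

theorem reciprocity_alt {g r : ℝ} (hg : 0 < g) (hr : 0 < r) :
    ((g + 1 / g) / (g + r) - 1) * g = (1 - g * r) / (g + r) := by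
  have : g + r ≠ 0 := by positivity
  field_simp
  ring

theorem reciprocity_div_pow_five {g a b : ℝ} (hb : b ≠ 0) :
    (1 - g * (a / b) ^ 5) / (g + (a / b) ^ 5) = (b ^ 5 - g * a ^ 5) / (g * b ^ 5 + a ^ 5) := by
  have h : b ^ 5 ≠ 0 := pow_ne_zero 5 hb
  rw [div_pow, ← mul_div_mul_right _ _ h]
  congr 1 <;> field_simp

/-- The Möbius map is an involution, so it sends v back to P / Q. Positivity of v yields both
nonvanishing claims, because division by zero is zero. -/
theorem reciprocity_div {g P Q S v : ℝ} (hg : 0 < g) (hv0 : 0 < v) (hS : S = g * Q + P)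
    (hv : v = (Q - g * P) / S) : Q ≠ 0 ∧ S ≠ 0 ∧ (1 - g * v) / (g + v) = P / Q := by
  have hS0 : S ≠ 0 := by
    rintro rfl
    rw [div_zero] at hv
    exact hv0.ne' hv
  have hQ : Q ≠ 0 := by
    rintro rfl
    rw [hS, eq_div_iff (hS ▸ hS0)] at hv
    have : (g + v) * P = 0 := by linear_combination hv
    rcases mul_eq_zero.mp this with h | h
    · linarith
    · rw [h] at hS
      exact hS0 (by simpa using hS)
  refine ⟨hQ, hS0, ?_⟩
  rw [div_eq_div_iff (by positivity) hQ]
  rw [eq_div_iff hS0, hS] at hv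
  linear_combination -hv

theorem sqrt_five_eq : √5 = 2 * φ - 1 := by
  rw [goldenRatio]; ring

theorem one_div_goldenRatio : 1 / φ = φ - 1 := by
  rw [div_eq_iff goldenRatio_ne_zero]
  linear_combination -goldenRatio_sq

/-- This is the modular cubic at T / S with denominators cleared. Each intermediate product is
reduced to the eight monomials in g, s, w of degree at most one in each, so that every step stays
small. -/
theorem degree_two_cubic {g s w x S T : ℝ} (hg : g ^ 2 = g + 1) (hs : s ^ 2 = g)
    (hw : w ^ 2 = 2 * g - 1) (hx : x = s * w - g) (hS : S = 2 * g - 1 - w)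
    (hT : T = s * (g + 2) - (g - 1) * w - (g + 2)) :
    x * T ^ 3 + x ^ 3 * T ^ 2 * S - T * S ^ 2 + x ^ 2 * S ^ 3 = 0 := by
  have hxT : x * T = 1 + 2 * w - 4 * s - 2 * s * w + 3 * g + 3 * g * w - 2 * g * s
      - g * s * w := by
    rw [hx, hT]
    linear_combination (2 * w + g * w) * hs + (s - g * s) * hw + (1 + 2 * w - 3 * s) * hg
  have hxx : x ^ 2 = 3 + 2 * g - 2 * g * s * w := by
    rw [hx]
    linear_combination w ^ 2 * hs + g * hw + 3 * hg
  have hTT : T ^ 2 = 6 - 2 * w - 10 * s + 2 * s * w + 18 * g + 4 * g * w - 10 * g * s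
      - 4 * g * s * w := by
    rw [hT]
    linear_combination (4 + 4 * g + g ^ 2) * hs + (1 - 2 * g + g ^ 2) * hw
      + (3 + 2 * w - 2 * s - 2 * s * w + 3 * g) * hg
  have hTS : T * S = 3 - w - 2 * s * w - 6 * g + 2 * g * w + 5 * g * s - g * s * w := by
    rw [hT, hS]
    linear_combination (-1 + g) * hw + (-2 * w + 2 * s) * hg
  have hSS : S ^ 2 = 4 + 2 * w + 2 * g - 4 * g * w := by
    rw [hS]
    linear_combination hw + 4 * hg
  have hxTS : x * T * S = 1 + 3 * w + 4 * s * w - 2 * g + 4 * g * w - 5 * g * s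
      - 3 * g * s * w := by
    rw [hxT, hS]
    linear_combination (-2 + 2 * s - 3 * g + g * s) * hw + (6 * w - 2 * s - 2 * s * w) * hg
  have h₁ : x * T * T ^ 2 = 170 + 136 * w - 140 * s - 90 * s * w + 290 * g + 208 * g * w
      - 230 * g * s - 170 * g * s * w := by
    rw [hxT, hTT]
    linear_combination (40 + 12 * w - 4 * w ^ 2 + 60 * g + 42 * g * w + 6 * g * w ^ 2 + 20 * g ^ 2
      + 18 * g ^ 2 * w + 4 * g ^ 2 * w ^ 2) * hs + (-4 + 8 * s - 2 * g - 8 * g * s + 18 * g ^ 2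
      - 16 * g ^ 2 * s + 4 * g ^ 3) * hw + (160 + 126 * w - 98 * s - 68 * s * w + 60 * g
      + 18 * g * w - 32 * g * s + 8 * g ^ 2) * hg
  have hxTST : x * T * S * T = -20 - 12 * w - 10 * s + 10 * s * w - 20 * g - 16 * g * w
      + 20 * g * s + 20 * g * s * w := by
    rw [hxTS, hT]
    linear_combination (8 * w - 10 * g - 2 * g * w - 5 * g ^ 2 - 3 * g ^ 2 * w) * hs
      + (3 + 4 * s + g - 7 * g * s - 4 * g ^ 2 + 3 * g ^ 2 * s) * hw
      + (-15 - 7 * w - 8 * s + 12 * s * w - 13 * g - 3 * g * w + 6 * g * s) * hg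
  have h₂ : x ^ 2 * (x * T * S * T) = -240 - 88 * w + 90 * s + 110 * s * w - 360 * g
      - 164 * g * w + 200 * g * s + 200 * g * s * w := by
    rw [hxTST, hxx]
    linear_combination (20 * g * w - 20 * g * w ^ 2 - 40 * g ^ 2 * w - 40 * g ^ 2 * w ^ 2) * hs
      + (24 * g * s - 20 * g ^ 2 + 32 * g ^ 2 * s - 40 * g ^ 3) * hw
      + (-180 - 52 * w + 120 * s + 80 * s * w - 80 * g - 40 * g * w + 64 * g * s
      - 80 * g ^ 2) * hg
  have h₃ : T * S * S = -20 + 2 * w + 10 * s + 6 * g * w + 10 * g * s - 10 * g * s * w := by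
    rw [hTS, hS]
    linear_combination (1 + 2 * s - 2 * g + g * s) * hw
      + (-16 + 4 * w + 12 * s - 2 * s * w) * hg
  have hxxS : x ^ 2 * S = 1 - 3 * w + 4 * s - 4 * s * w + 8 * g - 2 * g * w + 2 * g * s
      - 2 * g * s * w := by
    rw [hxx, hS]
    linear_combination 2 * g * s * hw + (4 + 4 * s - 4 * s * w) * hg
  have h₄ : x ^ 2 * S * S ^ 2 = 50 - 46 * w + 60 * s - 20 * s * w + 70 * g - 38 * g * w
      + 40 * g * s - 40 * g * s * w := by
    rw [hxxS, hSS]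
    linear_combination (-6 - 8 * s + 8 * g + 12 * g * s + 8 * g ^ 2 + 8 * g ^ 2 * s) * hw
      + (40 - 36 * w + 36 * s - 12 * s * w + 16 * g + 16 * g * s) * hg
  linear_combination h₁ + h₂ - h₃ + h₄

/-- Two roots in `(-1, 1)` of the degree-two modular cubic with a small parameter coincide. -/
theorem degree_two_root_unique {x v t : ℝ} (hx0 : 0 < x) (hx1 : x < 0.3) (hv0 : 0 < v)
    (hv1 : v < 1) (ht0 : -1 < t) (ht1 : t < 1)
    (hv : x * v ^ 3 + x ^ 3 * v ^ 2 - v + x ^ 2 = 0)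
    (ht : x * t ^ 3 + x ^ 3 * t ^ 2 - t + x ^ 2 = 0) : v = t := by
  -- The cofactor of v - t is below 0.3 * 3 + 0.03 * 2 - 1 < 0.
  have hdiff : (v - t) * (x * (v ^ 2 + v * t + t ^ 2) + x ^ 3 * (v + t) - 1) = 0 := by
    linear_combination hv - ht
  rcases mul_eq_zero.mp hdiff with h' | h'
  · linarith
  · exfalso
    have k1 : v ^ 2 + v * t + t ^ 2 ≤ 3 := by nlinarith
    have k2 : x ^ 3 < 0.03 := by
      calc x ^ 3 < 0.3 ^ 3 := by gcongr
        _ < 0.03 := by norm_num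
    have k3 : 0 < x ^ 3 := by positivity
    have k4 : x * (v ^ 2 + v * t + t ^ 2) ≤ 0.3 * 3 := by
      have : 0 ≤ v ^ 2 + v * t + t ^ 2 := by nlinarith [sq_nonneg (v + t)]
      gcongr
    have k5 : x ^ 3 * (v + t) ≤ x ^ 3 * 2 := by gcongr; linarith
    linarith

theorem goldenRatio_bounds : 1.618 < φ ∧ φ < 1.6181 := by
  have h5 : √5 ^ 2 = 5 := sq_sqrt (by norm_num)
  have h50 := sqrt_nonneg 5
  have hs5 := sqrt_five_eq
  have h1 : 2.236 < √5 := lt_sqrt_of_sq_lt (by norm_num)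
  have h2 : √5 < 2.2361 := (sqrt_lt' (by norm_num)).mpr (by norm_num)
  constructor <;> linarith

/-- The value of the continued fraction at `exp (-4 π)`. -/
theorem degree_two_root {x v : ℝ} (hx : x = √(φ ^ 2 + 1) - φ) (hv0 : 0 < v) (hv1 : v < 1)
    (h : v - x ^ 2 = (v + x ^ 2) * (x * v ^ 2)) :
    v = ((√φ - 1 / φ * √(φ + 1 / φ)) - φ * (φ + 1 / φ - φ * √φ)) /
        (φ + 1 / φ - √(φ + 1 / φ)) := by
  have hg := goldenRatio_sq
  have hφ0 := goldenRatio_pos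
  obtain ⟨hφl, hφu⟩ := goldenRatio_bounds
  rw [one_div_goldenRatio, show φ + (φ - 1) = 2 * φ - 1 by ring]
  have hw := sq_sqrt (show 0 ≤ 2 * φ - 1 by linarith)
  have hs := sq_sqrt hφ0.le
  have hsl : 1.27 < √φ := lt_sqrt_of_sq_lt (by norm_num; linarith)
  have hsu : √φ < 1.275 := (sqrt_lt' (by norm_num)).mpr (by norm_num; linarith)
  have hwl : 1.49 < √(2 * φ - 1) := lt_sqrt_of_sq_lt (by norm_num; linarith)
  have hwu : √(2 * φ - 1) < 1.5 := (sqrt_lt' (by norm_num)).mpr (by norm_num; linarith)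
  have hxsw : x = √φ * √(2 * φ - 1) - φ := by
    rw [hx, ← sqrt_mul hφ0.le]
    congr 2
    linear_combination -hg
  generalize √φ = s at *
  generalize √(2 * φ - 1) = w at *
  generalize φ = g at *
  have hT : s - (g - 1) * w - g * (2 * g - 1 - g * s) =
      s * (g + 2) - (g - 1) * w - (g + 2) := by
    linear_combination (s - 2) * hg
  rw [hT]
  have hS0 : 0 < 2 * g - 1 - w := by linarith
  have hcub := degree_two_cubic hg hs hw hxsw rfl rfl
  have b1 : 1.27 * 3.618 < s * (g + 2) := by gcongr; linarith
  have b2 : s * (g + 2) < 1.275 * 3.6181 := by gcongr; linarith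
  have b3 : 0.618 * 1.49 < (g - 1) * w := by gcongr; linarith
  have b4 : (g - 1) * w < 0.6181 * 1.5 := by gcongr <;> linarith
  have b5 : 1.27 * 1.49 < s * w := by gcongr
  have b6 : s * w < 1.275 * 1.5 := by gcongr
  refine degree_two_root_unique (x := x) (by linarith) (by linarith) hv0 hv1 ?_ ?_
    (by linear_combination -h) ?_
  · rw [lt_div_iff₀ hS0]; linarith
  · rw [div_lt_one hS0]; linarith
  · generalize 2 * g - 1 - w = S at *
    generalize s * (g + 2) - (g - 1) * w - (g + 2) = T at *
    field_simp
    linear_combination hcub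

/-- The nested radical form of the value at `exp (-π)`. -/
theorem nested_radical_eq :
    (-√(√5) * (√5 + 5) + √(2 * √5 + 5) + √(5 * (2 * √5 + 5))) /
        (2 * (√5 - √(2 * √5 + 5))) =
      (φ + 1 / φ - φ * √φ) / (√φ - 1 / φ * √(φ + 1 / φ)) := by
  have hg := goldenRatio_sq
  have hφ0 := goldenRatio_pos
  have hφ1 := one_lt_goldenRatio
  have hφ2 := goldenRatio_lt_two
  have hs5 := sqrt_five_eq
  rw [one_div_goldenRatio]
  have hs := sq_sqrt hφ0.le
  have hs0 := sqrt_pos.mpr hφ0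
  have hw := sq_sqrt (show 0 ≤ φ + (φ - 1) by linarith)
  have hw0 := sqrt_pos.mpr (show 0 < φ + (φ - 1) by linarith)
  have e1 : √(√5) = √(φ + (φ - 1)) := by
    congr 1
    linarith
  have e2 : √(2 * √5 + 5) = √(φ + (φ - 1)) * (φ * √φ) := by
    -- Here 2√5 + 5 = √5 φ³, so that only √φ and the fourth root of 5 remain.
    rw [sqrt_eq_iff_mul_self_eq (by positivity) (by positivity), hs5]
    clear hs5 e1
    generalize √φ = s at *
    generalize √(φ + (φ - 1)) = w at *
    generalize φ = g at *
    linear_combination -(g ^ 3 * hw + g ^ 2 * w ^ 2 * hs + (2 * g ^ 2 + g + 3) * hg)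
  have e3 : √(5 * (2 * √5 + 5)) = √5 * (√(φ + (φ - 1)) * (φ * √φ)) := by
    rw [sqrt_mul (by norm_num), e2]
  rw [e3, e1, e2, hs5]
  generalize √φ = s at *
  generalize √(φ + (φ - 1)) = w at *
  have hsw : w < φ * s := by
    refine lt_of_pow_lt_pow_left₀ 2 (by positivity) ?_
    rw [mul_pow, hs, hw]
    nlinarith
  have d1 : 2 * (2 * φ - 1 - w * (φ * s)) ≠ 0 := by
    have : 2 * (2 * φ - 1 - w * (φ * s)) = 2 * (w * (w - φ * s)) := by linear_combination -2 * hw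
    rw [this]
    exact mul_ne_zero two_ne_zero (mul_ne_zero hw0.ne' (by linarith))
  have d2 : s - (φ - 1) * w ≠ 0 := by
    have : φ * (s - (φ - 1) * w) = φ * s - w := by linear_combination -w * hg
    intro h0
    rw [h0, mul_zero] at this
    linarith
  rw [div_eq_div_iff d1 d2]
  clear hs5 e1 e2 e3
  generalize φ = g at *
  linear_combination (-4 + 2 * g + 2 * g ^ 2 + 2 * g ^ 2 * s - 2 * g ^ 3 * s) * hw
    + (-2 + 4 * s * w + 4 * g + 2 * g * s - 4 * g ^ 2 * s) * hg

/-- The radical in the evaluation at `exp (-2 π √5)`. -/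
theorem five_rpow_radical_eq :
    (5 : ℝ) ^ (3 / 4 : ℝ) * ((√5 - 1) / 2) ^ (5 / 2 : ℝ) - 1 =
      (√(φ ^ 10 + 1) - φ ^ 5) / φ ^ 5 := by
  have hφ0 := goldenRatio_pos
  have hg := goldenRatio_sq
  have e : (√5 - 1) / 2 = 1 / φ := by
    rw [one_div_goldenRatio, sqrt_five_eq]; ring
  rw [e]
  have h1 : ((5 : ℝ) ^ (3 / 4 : ℝ)) ^ 2 = 5 * √5 := by
    rw [← rpow_natCast, ← rpow_mul (by norm_num), sqrt_eq_rpow]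
    nth_rewrite 2 [← rpow_one (5 : ℝ)]
    rw [← rpow_add (by norm_num)]
    norm_num
  have h2 : ((1 / φ) ^ (5 / 2 : ℝ)) ^ 2 = 1 / φ ^ 5 := by
    rw [← rpow_natCast, ← rpow_mul (by positivity), ← one_div_pow, ← rpow_natCast]
    norm_num
  -- This rests on φ^5 + φ^(-5) = 5√5.
  have h3 : √(φ ^ 10 + 1) = φ ^ 5 * ((5 : ℝ) ^ (3 / 4 : ℝ) * (1 / φ) ^ (5 / 2 : ℝ)) := by
    rw [sqrt_eq_iff_mul_self_eq (by positivity) (by positivity), ← pow_two, mul_pow, mul_pow, h1, h2,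
      sqrt_five_eq]
    have h10 : φ ^ 10 = (φ ^ 5) ^ 2 := by ring
    have hG := goldenRatio_pow_five
    rw [h10]
    clear h1 h2 e h10
    have hG0 : φ ^ 5 ≠ 0 := by positivity
    generalize φ ^ 5 = G at *
    generalize φ = g at *
    field_simp
    rw [hG]
    linear_combination -25 * hg
  rw [h3]
  field_simp

/-! ### The evaluations. -/

theorem mainTheorem2 :
    -- the continued fraction `R(q)` converges for `0 < q < 1`
    (∀ q : ℝ, 0 < q → q < 1 →
      Tendsto (rrContFract (q ^ (1 / 5 : ℝ)) q).convs atTop (𝓝 (rrR q))) ∧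
    -- reciprocity formula for `R`
    (∀ α β : ℝ, 0 < α → 0 < β → α * β = π ^ 2 →
      rrR (exp (-2 * α)) = ((φ + 1 / φ) / (φ + rrR (exp (-2 * β))) - 1) * φ ∧
      rrR (exp (-2 * α)) = (1 - φ * rrR (exp (-2 * β))) / (φ + rrR (exp (-2 * β)))) ∧
    -- reciprocity formula for `R ^ 5`
    (∀ α β : ℝ, 0 < α → 0 < β → α * β = π ^ 2 / 5 →
      rrR (exp (-2 * α)) ^ 5 =
        ((φ ^ 5 + 1 / φ ^ 5) / (φ ^ 5 + rrR (exp (-2 * β)) ^ 5) - 1) * φ ^ 5 ∧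
      rrR (exp (-2 * α)) ^ 5 =
        (1 - φ ^ 5 * rrR (exp (-2 * β)) ^ 5) / (φ ^ 5 + rrR (exp (-2 * β)) ^ 5)) ∧
    -- the two formulas along the powers of `√5`
    (∀ n : ℕ,
      rrR (exp (-2 * π * √5 ^ n)) =
        (1 - φ * rrR (exp (-2 * π / √5 ^ n))) / (φ + rrR (exp (-2 * π / √5 ^ n))) ∧
      rrR (exp (-2 * π / √5 ^ (n + 2))) ^ 5 =
        (1 - φ ^ 5 * rrR (exp (-2 * π * √5 ^ n)) ^ 5) /
          (φ ^ 5 + rrR (exp (-2 * π * √5 ^ n)) ^ 5)) ∧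
    -- (1)
    rrR (exp (-2 * π)) = √(φ ^ 2 + 1) - φ ∧
    rrR (exp (-2 * π / 5)) ^ 5 =
      (1 - φ ^ 5 * (√(φ ^ 2 + 1) - φ) ^ 5) / (φ ^ 5 + (√(φ ^ 2 + 1) - φ) ^ 5) ∧
    rrR (exp (-10 * π)) =
      ((φ ^ 5 + (√(φ ^ 2 + 1) - φ) ^ 5) ^ (1 / 5 : ℝ)
          - φ * (1 - φ ^ 5 * (√(φ ^ 2 + 1) - φ) ^ 5) ^ (1 / 5 : ℝ)) /
        (φ * (φ ^ 5 + (√(φ ^ 2 + 1) - φ) ^ 5) ^ (1 / 5 : ℝ)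
          + (1 - φ ^ 5 * (√(φ ^ 2 + 1) - φ) ^ 5) ^ (1 / 5 : ℝ)) ∧
    -- (2)
    rrR (exp (-2 * π / √5)) ^ 5 = √(φ ^ 10 + 1) - φ ^ 5 ∧
    rrR (exp (-2 * π * √5)) =
      (1 - φ * (√(φ ^ 10 + 1) - φ ^ 5) ^ (1 / 5 : ℝ)) /
        (φ + (√(φ ^ 10 + 1) - φ ^ 5) ^ (1 / 5 : ℝ)) ∧
    Tendsto (rrContFract 1 (exp (-2 * π * √5))).convs atTop
      (𝓝 ((√5 / (1 + ((5 : ℝ) ^ (3 / 4 : ℝ) * ((√5 - 1) / 2) ^ (5 / 2 : ℝ) - 1) ^ (1 / 5 : ℝ))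
          - (√5 + 1) / 2) * exp (2 * π / √5))) ∧
    rrR (exp (-2 * π / (5 * √5))) ^ 5 =
      ((φ + (√(φ ^ 10 + 1) - φ ^ 5) ^ (1 / 5 : ℝ)) ^ 5
          - φ ^ 5 * (1 - φ * (√(φ ^ 10 + 1) - φ ^ 5) ^ (1 / 5 : ℝ)) ^ 5) /
        (φ ^ 5 * (φ + (√(φ ^ 10 + 1) - φ ^ 5) ^ (1 / 5 : ℝ)) ^ 5
          + (1 - φ * (√(φ ^ 10 + 1) - φ ^ 5) ^ (1 / 5 : ℝ)) ^ 5) ∧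
    rrR (exp (-10 * √5 * π)) =
      ((φ ^ 5 * (φ + (√(φ ^ 10 + 1) - φ ^ 5) ^ (1 / 5 : ℝ)) ^ 5
            + (1 - φ * (√(φ ^ 10 + 1) - φ ^ 5) ^ (1 / 5 : ℝ)) ^ 5) ^ (1 / 5 : ℝ)
          - φ * ((φ + (√(φ ^ 10 + 1) - φ ^ 5) ^ (1 / 5 : ℝ)) ^ 5
            - φ ^ 5 * (1 - φ * (√(φ ^ 10 + 1) - φ ^ 5) ^ (1 / 5 : ℝ)) ^ 5) ^ (1 / 5 : ℝ)) /
        (φ * (φ ^ 5 * (φ + (√(φ ^ 10 + 1) - φ ^ 5) ^ (1 / 5 : ℝ)) ^ 5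
            + (1 - φ * (√(φ ^ 10 + 1) - φ ^ 5) ^ (1 / 5 : ℝ)) ^ 5) ^ (1 / 5 : ℝ)
          + ((φ + (√(φ ^ 10 + 1) - φ ^ 5) ^ (1 / 5 : ℝ)) ^ 5
            - φ ^ 5 * (1 - φ * (√(φ ^ 10 + 1) - φ ^ 5) ^ (1 / 5 : ℝ)) ^ 5) ^ (1 / 5 : ℝ)) ∧
    -- (3)
    rrR (exp (-π)) =
      (-√(√5) * (√5 + 5) + √(2 * √5 + 5) + √(5 * (2 * √5 + 5))) /
        (2 * (√5 - √(2 * √5 + 5))) ∧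
    rrR (exp (-π)) = (φ + 1 / φ - φ * √φ) / (√φ - 1 / φ * √(φ + 1 / φ)) ∧
    rrR (exp (-4 * π)) =
      ((√φ - 1 / φ * √(φ + 1 / φ)) - φ * (φ + 1 / φ - φ * √φ)) /
        (φ + 1 / φ - √(φ + 1 / φ)) ∧
    rrR (exp (-4 * π / 5)) ^ 5 =
      ((√φ - 1 / φ * √(φ + 1 / φ)) ^ 5 - φ ^ 5 * (φ + 1 / φ - φ * √φ) ^ 5) /
        (φ ^ 5 * (√φ - 1 / φ * √(φ + 1 / φ)) ^ 5 + (φ + 1 / φ - φ * √φ) ^ 5) ∧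
    rrR (exp (-π / 5)) ^ 5 =
      ((φ + 1 / φ - √(φ + 1 / φ)) ^ 5
          - φ ^ 5 * ((√φ - 1 / φ * √(φ + 1 / φ)) - φ * (φ + 1 / φ - φ * √φ)) ^ 5) /
        (φ ^ 5 * (φ + 1 / φ - √(φ + 1 / φ)) ^ 5
          + ((√φ - 1 / φ * √(φ + 1 / φ)) - φ * (φ + 1 / φ - φ * √φ)) ^ 5) := by
  have hφ0 := goldenRatio_pos
  have hφ5 : 0 < φ ^ 5 := pow_pos hφ0 5
  have hπ := pi_pos
  have h50 : 0 < √5 := sqrt_pos.mpr (by norm_num)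
  have h5sq : √5 ^ 2 = 5 := sq_sqrt (by norm_num)
  have hrec : ∀ α β : ℝ, 0 < α → 0 < β → α * β = π ^ 2 →
      rrR (exp (-2 * α)) = (1 - φ * rrR (exp (-2 * β))) / (φ + rrR (exp (-2 * β))) :=
    fun α β hα hβ h => rrR_reciprocity hα hβ h
  have hrec5 : ∀ α β : ℝ, 0 < α → 0 < β → α * β = π ^ 2 / 5 →
      rrR (exp (-2 * α)) ^ 5 =
        (1 - φ ^ 5 * rrR (exp (-2 * β)) ^ 5) / (φ ^ 5 + rrR (exp (-2 * β)) ^ 5) :=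
    fun α β hα hβ h => rrR_pow_five_reciprocity hα hβ h
  have hpows : ∀ n : ℕ,
      rrR (exp (-2 * π * √5 ^ n)) =
        (1 - φ * rrR (exp (-2 * π / √5 ^ n))) / (φ + rrR (exp (-2 * π / √5 ^ n))) ∧
      rrR (exp (-2 * π / √5 ^ (n + 2))) ^ 5 =
        (1 - φ ^ 5 * rrR (exp (-2 * π * √5 ^ n)) ^ 5) /
          (φ ^ 5 + rrR (exp (-2 * π * √5 ^ n)) ^ 5) := fun n => by
    have hn : 0 < √5 ^ n := pow_pos h50 n
    constructor
    · have h := hrec (π * √5 ^ n) (π / √5 ^ n) (by positivity) (by positivity) (by field_simp)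
      rwa [← mul_assoc, ← mul_div_assoc] at h
    · have h := hrec5 (π / √5 ^ (n + 2)) (π * √5 ^ n) (by positivity) (by positivity)
        (by rw [pow_add, h5sq]; field_simp)
      rwa [← mul_assoc, ← mul_div_assoc] at h
  have hx : rrR (exp (-2 * π)) = √(φ ^ 2 + 1) - φ :=
    eq_sqrt_sub_of_fixed hφ0 (rrR_exp_pos hπ) (hrec π π hπ hπ (by ring))
  have hx5 : rrR (exp (-2 * π / 5)) ^ 5 =
      (1 - φ ^ 5 * (√(φ ^ 2 + 1) - φ) ^ 5) / (φ ^ 5 + (√(φ ^ 2 + 1) - φ) ^ 5) := by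
    have h := hrec5 (π / 5) π (by positivity) hπ (by ring)
    rwa [hx, ← mul_div_assoc] at h
  have hxpos : 0 < √(φ ^ 2 + 1) - φ := hx ▸ rrR_exp_pos hπ
  have hz5 : rrR (exp (-2 * π / √5)) ^ 5 = √(φ ^ 10 + 1) - φ ^ 5 := by
    have h := hrec5 (π / √5) (π / √5) (by positivity) (by positivity) (by field_simp; rw [h5sq])
    rw [← mul_div_assoc] at h
    have hp : 0 < rrR (exp (-2 * π / √5)) := by
      rw [mul_div_assoc]; exact rrR_exp_pos (by positivity)
    rw [eq_sqrt_sub_of_fixed hφ5 (pow_pos hp 5) h, ← pow_mul]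
  have hzpos : 0 < rrR (exp (-2 * π / √5)) := by
    rw [mul_div_assoc]; exact rrR_exp_pos (by positivity)
  have hz : (√(φ ^ 10 + 1) - φ ^ 5) ^ (1 / 5 : ℝ) = rrR (exp (-2 * π / √5)) := by
    rw [← hz5, rpow_one_fifth_pow hzpos.le]
  have hy : rrR (exp (-2 * π * √5)) =
      (1 - φ * (√(φ ^ 10 + 1) - φ ^ 5) ^ (1 / 5 : ℝ)) /
        (φ + (√(φ ^ 10 + 1) - φ ^ 5) ^ (1 / 5 : ℝ)) := by
    have h := (hpows 1).1
    rwa [pow_one, ← hz] at h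
  have hypos : 0 < rrR (exp (-2 * π * √5)) := by
    rw [mul_assoc]; exact rrR_exp_pos (by positivity)
  have hz0 : 0 < (√(φ ^ 10 + 1) - φ ^ 5) ^ (1 / 5 : ℝ) := hz ▸ hzpos
  have hcf : Tendsto (rrContFract 1 (exp (-2 * π * √5))).convs atTop
      (𝓝 ((√5 / (1 + ((5 : ℝ) ^ (3 / 4 : ℝ) * ((√5 - 1) / 2) ^ (5 / 2 : ℝ) - 1) ^ (1 / 5 : ℝ))
          - (√5 + 1) / 2) * exp (2 * π / √5))) := by
    have hq1 : exp (-2 * π * √5) < 1 := Real.exp_lt_one_iff.mpr (by nlinarith [mul_pos hπ h50])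
    have h := (rogers_pos_and_tendsto_convs (exp_pos (-2 * π * √5)) hq1).2.2 1 zero_le_one
    have hR := rrR_eq (exp_pos (-2 * π * √5)) hq1
    have hE : exp (-2 * π * √5) ^ (1 / 5 : ℝ) = (exp (2 * π / √5))⁻¹ := by
      rw [← Real.exp_mul, ← Real.exp_neg]
      congr 1
      field_simp
      rw [h5sq]
    have hdiv : ((√(φ ^ 10 + 1) - φ ^ 5) / φ ^ 5) ^ (1 / 5 : ℝ) =
        (√(φ ^ 10 + 1) - φ ^ 5) ^ (1 / 5 : ℝ) / φ := by
      rw [← hz5, div_rpow (pow_pos hzpos 5).le hφ5.le, rpow_one_fifth_pow hφ0.le]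
    -- Since √5 = φ + 1/φ, the bracket is the alternative form of the first reciprocity map at z.
    have hval : √5 / (1 + (√(φ ^ 10 + 1) - φ ^ 5) ^ (1 / 5 : ℝ) / φ) - (√5 + 1) / 2 =
        rrR (exp (-2 * π * √5)) := by
      have hg := goldenRatio_sq
      rw [hy, sqrt_five_eq]
      clear hy hE hdiv h hR hx hx5 hz5 hz hrec hrec5 hpows hxpos
      generalize (√(φ ^ 10 + 1) - φ ^ 5) ^ (1 / 5 : ℝ) = z at *
      generalize φ = g at *
      have : g + z ≠ 0 := by positivity
      field_simp
      linear_combination (2 : ℝ) * hg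
    rw [five_rpow_radical_eq, hdiv, hval, hR, hE]
    convert h using 2
    rw [mul_comm, ← mul_assoc, mul_inv_cancel₀ (exp_pos _).ne']
    rfl
  have hNM : rrR (exp (-2 * π / (5 * √5))) ^ 5 =
      ((φ + (√(φ ^ 10 + 1) - φ ^ 5) ^ (1 / 5 : ℝ)) ^ 5
          - φ ^ 5 * (1 - φ * (√(φ ^ 10 + 1) - φ ^ 5) ^ (1 / 5 : ℝ)) ^ 5) /
        (φ ^ 5 * (φ + (√(φ ^ 10 + 1) - φ ^ 5) ^ (1 / 5 : ℝ)) ^ 5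
          + (1 - φ * (√(φ ^ 10 + 1) - φ ^ 5) ^ (1 / 5 : ℝ)) ^ 5) := by
    have h := hrec5 (π / (5 * √5)) (π * √5) (by positivity) (by positivity) (by field_simp)
    rw [← mul_assoc, ← mul_div_assoc] at h
    rw [h, hy, reciprocity_div_pow_five (add_pos hφ0 hz0).ne']
  -- The sign of 1 - φz comes from the positivity of R(e^(-2π√5)).
  have hMpos : 0 < φ ^ 5 * (φ + (√(φ ^ 10 + 1) - φ ^ 5) ^ (1 / 5 : ℝ)) ^ 5
          + (1 - φ * (√(φ ^ 10 + 1) - φ ^ 5) ^ (1 / 5 : ℝ)) ^ 5 := by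
    have h1 := hypos
    rw [hy] at h1
    have h2 := (div_pos_iff_of_pos_right (add_pos hφ0 hz0)).mp h1
    positivity
  have hv : rrR (exp (-4 * π)) =
      ((√φ - 1 / φ * √(φ + 1 / φ)) - φ * (φ + 1 / φ - φ * √φ)) /
        (φ + 1 / φ - √(φ + 1 / φ)) := by
    have e4 : exp (-2 * π) ^ 2 = exp (-2 * (2 * π)) := by
      rw [← Real.exp_nat_mul]; congr 1; push_cast; ring
    have h := rrR_degree_two (exp_pos (-2 * π)) (Real.exp_lt_one_iff.mpr (by linarith))
    rw [e4, hx] at h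
    rw [show -4 * π = -2 * (2 * π) by ring]
    exact degree_two_root rfl (rrR_exp_pos (by positivity)) (rrR_exp_lt_one (by positivity)) h
  have hv0 : 0 < rrR (exp (-4 * π)) := by
    rw [show -4 * π = -2 * (2 * π) by ring]; exact rrR_exp_pos (by positivity)
  obtain ⟨hQ, hS, huv⟩ := reciprocity_div hφ0 hv0
    (show φ + 1 / φ - √(φ + 1 / φ) = φ * (√φ - 1 / φ * √(φ + 1 / φ)) + (φ + 1 / φ - φ * √φ) by
      rw [mul_sub, ← mul_assoc, mul_one_div_cancel hφ0.ne']; ring) hv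
  have hu : rrR (exp (-π)) = (φ + 1 / φ - φ * √φ) / (√φ - 1 / φ * √(φ + 1 / φ)) := by
    have h := hrec (π / 2) (2 * π) (by positivity) (by positivity) (by ring)
    rw [show -2 * (π / 2) = -π by ring, show -2 * (2 * π) = -4 * π by ring] at h
    rw [h, huv]
  refine ⟨fun q h0 h1 => ?_, fun α β hα hβ h => ⟨?_, hrec α β hα hβ h⟩,
    fun α β hα hβ h => ⟨?_, hrec5 α β hα hβ h⟩, hpows, hx, hx5, ?_, hz5, hy, hcf, hNM, ?_,
    ?_, hu, hv, ?_, ?_⟩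
  · rw [rrR_eq h0 h1]
    exact tendsto_rrR h0 h1
  · rw [reciprocity_alt hφ0 (rrR_exp_pos hβ)]
    exact hrec α β hα hβ h
  · rw [reciprocity_alt hφ5 (pow_pos (rrR_exp_pos hβ) 5)]
    exact hrec5 α β hα hβ h
  · have h := hrec (5 * π) (π / 5) (by positivity) (by positivity) (by ring)
    rw [show -2 * (5 * π) = -10 * π by ring, ← mul_div_assoc] at h
    rw [h]
    refine reciprocity_of_pow_five_eq_div ?_ (by positivity) hx5
    rw [mul_div_assoc]
    exact rrR_exp_pos (by positivity)
  · have h := hrec (5 * √5 * π) (π / (5 * √5)) (by positivity) (by positivity) (by field_simp)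
    rw [show -2 * (5 * √5 * π) = -10 * √5 * π by ring, ← mul_div_assoc] at h
    rw [h]
    refine reciprocity_of_pow_five_eq_div ?_ hMpos hNM
    rw [mul_div_assoc]
    exact rrR_exp_pos (by positivity)
  · rw [nested_radical_eq, hu]
  · have h := hrec5 (2 * π / 5) (π / 2) (by positivity) (by positivity) (by ring)
    rw [show -2 * (2 * π / 5) = -4 * π / 5 by ring, show -2 * (π / 2) = -π by ring, hu,
      reciprocity_div_pow_five hQ] at h
    exact h
  · have h := hrec5 (π / 10) (2 * π) (by positivity) (by positivity) (by ring)
    rw [show -2 * (π / 10) = -π / 5 by ring, show -2 * (2 * π) = -4 * π by ring, hv,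
      reciprocity_div_pow_five hS] at h
    exact h
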